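/- **Setting.** Let $K,N,M$ and $N_{T,k},N_{R,k}$ ($1\le k\le K$) be non-negative integers, $n_T=\sum_k N_{T,k}$, $n_R=\sum_k N_{R,k}$. Let $h\in\mathbb C^{N}$, $H\in\mathbb C^{N\times n_T}$, $h_E\in\mathbb C^{n_R}$, $\tilde H\in\mathbb C^{n_R\times n_T}$, $g_{sp}\in\mathbb C^N$, $g_E\in\mathbb C^{n_T+n_R}$, $G\in\mathbb C^{M\times N}$ be arbitrary channels, $\theta\in\mathbb R$, $P_p,P_0,\eta,C>0$, $\sigma_{n_a},\sigma_{n_c},\sigma_{EAP},\sigma_{PR},\sigma_{SR}>0$, $c_1,c_2,c_3,c_4\ge0$, and fix $\bar\varrho\in[0,1]$. For $X\succeq0$ put $$A(X)=(1-\bar\varrho)(HXH^H+\sigma_{n_a}^2I)+\sigma_{n_c}^2I,\qquad B(X)=\theta^2\tilde HX\tilde H^H+\sigma_{EAP}^2I,$$ $$\gamma_1(X)=(1-\bar\varrho)P_p\,h^HA(X)^{-1}h,\qquad \gamma_2(X)=P_p\,h_E^HB(X)^{-1}h_E,$$ $P_{EH}(X)=\mathrm{Tr}(HXH^H)+P_p\|h\|^2$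 and $r_{SR}(Q)=\frac12\log_2\det(I+\sigma_{SR}^{-2}GQG^H)$. Let $(i,j)=(1,2)$ or $(i,j)=(2,1)$. The non-convex subproblem $(\mathrm{P1}.i\text{-}1)$ in the variables $X,Q_s$ (Hermitian), $w_p\in\mathbb C^N$, $v_p=(v_{p,k})_k$ with $v_{p,k}\in\mathbb C^{N_{T,k}+N_{R,k}}$, $t\in\mathbb R$, is to maximize $\frac12c_1\log_2(1+t)+c_2r_{SR}(Q_s)$ subject to $\|v_{p,k}\|^2\le P_0$ and $\mathrm{Tr}(E_kX)\le P_0$ for all $k$ ($E_k$ is the $0/1$ diagonal matrix that selects the $k$-th block of size $N_{T,k}$), $$\gamma_i(X)\ge\gamma_j(X),\quad \gamma_i(X)\ge t,\quad \frac{|g_{sp}^Hw_p+g_E^Hv_p|^2}{g_{sp}^HQ_sg_{sp}+\sigma_{PR}^2}\ge t,\quad \mathrm{Tr}(Q_s)+\|w_p\|^2\le\eta\bar\varrho P_{EH}(X),$$ $$c_3\eta\bar\varrho\,\mathrm{Tr}(HXH^H)+c_4|g_E^Hv_p|^2\le C,\qquad X\succeq0,\ Q_s\succeq0,\ t\ge0.$$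 Its convexification $(\mathrm{P1}.i\text{-}1')$ at $(\bar X,\bar t,\bar y)$, with $\bar X\succeq 0$ and $\bar t,\bar y>0$, has an additional variable $y\ge0$ and the same objective; it is obtained by replacing $\gamma_i(X)$ in the constraints $\gamma_i(X)\ge\gamma_j(X)$ and $\gamma_i(X)\ge t$ by its first-order Taylor expansion at $\bar X$, and the constraint on $|g_{sp}^Hw_p+g_E^Hv_p|^2$ by $$g_{sp}^HQ_sg_{sp}+\sigma_{PR}^2\le y,\qquad \Re\{g_{sp}^Hw_p+g_E^Hv_p\}\ge\sqrt{\bar t\bar y}+\tfrac12\sqrt{\bar y/\bar t}\,(t-\bar t)+\tfrac12\sqrt{\bar t/\bar y}\,(y-\bar y).$$ **Iterations.** Let $(X^{(n)},Q_s^{(n)},w_p^{(n)},v_p^{(n)},t^{(n)},y^{(n)})_{n\ge0}$ be iterates of the successive convex approximation (SCA): the $0$-th one is feasible for $(\mathrm{P1}.i\text{-}1')$ at some $(\bar X,\bar t,\bar y)$ with $\bar X\succeq0$, $\bar t,\bar y>0$; the $(n+1)$-st one is an optimal solution of $(\mathrm{P1}.i\text{-}1')$ at $(X^{(n)},t^{(n)},y^{(n)})$;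 and $t^{(n)}>0$ for all $n$, so that these problems are defined. **Proposition 4.1.** For each of $(\mathrm{P1.1}\text{-}1)$ and $(\mathrm{P1.2}\text{-}1)$: 1. The objective values are non-decreasing: $\frac12c_1\log_2(1+t^{(n+1)})+c_2r_{SR}(Q_s^{(n+1)})\ge\frac12c_1\log_2(1+t^{(n)})+c_2r_{SR}(Q_s^{(n)})$ for all $n\ge0$. They converge to a real number $h^*$. 2. The sequence $(X^{(n)},Q_s^{(n)},w_p^{(n)},v_p^{(n)},t^{(n)})$ is bounded, and so has an accumulation point. 3. Every accumulation point $(X^*,Q_s^*,w_p^*,v_p^*,t^*)$ has objective value $h^*$ and satisfies all the constraints of $(\mathrm{P1}.i\text{-}1)$. Suppose moreover that $t^*>0$, that $\eta\bar\varrho P_{EH}(X^*)>0$, and that, in case $\gamma_1(X^*)=\gamma_2(X^*)$, the Mangasarian–Fromovitz (Robinson) constraint qualification of $(\mathrm{P1}.i\text{-}1)$ holds at the point: there is a direction $(\Delta X,\Delta Q,\Delta w,\Delta v,\Delta t)$ with $X^*+\Delta X\succ0$ and $Q_s^*+\Delta Q\succ0$ along which every active scalar inequality constraint, written as $f\ge0$,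 has a positive directional derivative. Then the point satisfies the KKT conditions of $(\mathrm{P1}.i\text{-}1)$: there are non-negative multipliers for the scalar inequality constraints and positive semidefinite multipliers for $X\succeq0$ and $Q_s\succeq0$, with complementary slackness, such that the derivative of the Lagrangian at the point vanishes in all directions with Hermitian $\Delta X,\Delta Q$. -/

import Mathlib

open Filter Topology
open scoped Matrix ComplexOrder

noncomputable section

namespace CCRN

/-- Index set of all transmitting (resp. receiving) antennas of the `K` EAPs. -/
abbrev Ant {K : ℕ} (n : Fin K → ℕ) : Type := (k : Fin K) × Fin (n k)

/-- Data of the network for a fixed power splitting ratio: `K` EAPs with `NT k` transmitting and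
`NR k` receiving antennas, `N` antennas at the ST and `M` antennas at the SR. -/
structure System (K N M : ℕ) (NT NR : Fin K → ℕ) where
  /-- channel from the PT to the ST -/
  hST : Fin N → ℂ
  /-- stacked channels from the EAPs to the ST -/
  HES : Matrix (Fin N) (Ant NT) ℂ
  /-- channel from the PT to the EAPs -/
  hEAP : Ant NR → ℂ
  /-- residual loop-interference channel of the EAPs -/
  HTR : Matrix (Ant NR) (Ant NT) ℂ
  /-- level of the residual loop interference -/
  θ : ℝ
  /-- Hermitian transpose of the channel from the ST to the PR -/
  gsp : Fin N → ℂ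
  /-- Hermitian transpose of the channel from all antennas of the EAPs to the PR -/
  gEAP : Ant (fun k => NT k + NR k) → ℂ
  /-- channel from the ST to the SR -/
  Gss : Matrix (Fin M) (Fin N) ℂ
  /-- transmit power of the PT -/
  Pp : ℝ
  /-- power budget of each EAP -/
  P0 : ℝ
  /-- energy conversion efficiency -/
  η : ℝ
  /-- the fixed power splitting ratio -/
  ρ : ℝ
  σna : ℝ
  σnc : ℝ
  σEAP : ℝ
  σPR : ℝ
  σSR : ℝ
  c₁ : ℝ
  c₂ : ℝ
  c₃ : ℝ
  c₄ : ℝ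
  /-- total budget of the ST -/
  C : ℝ

/-- The ranges of the scalar parameters. -/
structure System.Admissible {K N M : ℕ} {NT NR : Fin K → ℕ} (S : System K N M NT NR) : Prop where
  Pp_pos : 0 < S.Pp
  P0_pos : 0 < S.P0
  η_pos : 0 < S.η
  ρ_nonneg : 0 ≤ S.ρ
  ρ_le_one : S.ρ ≤ 1
  σna_pos : 0 < S.σna
  σnc_pos : 0 < S.σnc
  σEAP_pos : 0 < S.σEAP
  σPR_pos : 0 < S.σPR
  σSR_pos : 0 < S.σSR
  c₁_nonneg : 0 ≤ S.c₁
  c₂_nonneg : 0 ≤ S.c₂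
  c₃_nonneg : 0 ≤ S.c₃
  c₄_nonneg : 0 ≤ S.c₄
  C_pos : 0 < S.C

/-- The optimization variables `(X, Q_s, w_p, v_p, t)`. The same type serves for directions. -/
@[ext] structure Point {K : ℕ} (N : ℕ) (NT NR : Fin K → ℕ) where
  X : Matrix (Ant NT) (Ant NT) ℂ
  Q : Matrix (Fin N) (Fin N) ℂ
  w : Fin N → ℂ
  v : Ant (fun k => NT k + NR k) → ℂ
  t : ℝ

/-- The point `x + τ d`. -/
def Point.along {K N : ℕ} {NT NR : Fin K → ℕ} (x d : Point N NT NR) (τ : ℝ) : Point N NT NR where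
  X := x.X + τ • d.X
  Q := x.Q + τ • d.Q
  w := x.w + τ • d.w
  v := x.v + τ • d.v
  t := x.t + τ * d.t

/-- Convergence of a sequence of points, componentwise. -/
structure Point.ConvergesTo {K N : ℕ} {NT NR : Fin K → ℕ} (x : ℕ → Point N NT NR)
    (a : Point N NT NR) : Prop where
  X : Tendsto (fun n => (x n).X) atTop (𝓝 a.X)
  Q : Tendsto (fun n => (x n).Q) atTop (𝓝 a.Q)
  w : Tendsto (fun n => (x n).w) atTop (𝓝 a.w)
  v : Tendsto (fun n => (x n).v) atTop (𝓝 a.v)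
  t : Tendsto (fun n => (x n).t) atTop (𝓝 a.t)

/-- Every entry of every component of `x` has absolute value at most `R`. -/
structure Point.BoundedBy {K N : ℕ} {NT NR : Fin K → ℕ} (x : Point N NT NR) (R : ℝ) : Prop where
  X : ∀ i j, ‖x.X i j‖ ≤ R
  Q : ∀ i j, ‖x.Q i j‖ ≤ R
  w : ∀ i, ‖x.w i‖ ≤ R
  v : ∀ i, ‖x.v i‖ ≤ R
  t : |x.t| ≤ R

/-- The node that attains the first-slot relaying rate: `st` gives the first subproblem
(the SINR of the ST dominates), `eap` the second one (the SINR of the EAPs dominates). -/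
inductive Node where
  | st : Node
  | eap : Node

def Node.other : Node → Node
  | .st => .eap
  | .eap => .st

/-- Labels of the scalar inequality constraints of the subproblems. -/
inductive Con (K : ℕ) where
  | wit (k : Fin K) : Con K
  | wpt (k : Fin K) : Con K
  | order : Con K
  | first : Con K
  | second : Con K
  | power : Con K
  | cost : Con K
  | tpos : Con K

variable {K N M : ℕ} {NT NR : Fin K → ℕ}

namespace System

/-- `A(ρ, X) = (1-ρ)(H X Hᴴ + σ_na² I) + σ_nc² I`. -/
def A (S : System K N M NT NR) (X : Matrix (Ant NT) (Ant NT) ℂ) : Matrix (Fin N) (Fin N) ℂ :=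
  (1 - S.ρ) • (S.HES * X * S.HESᴴ + (S.σna ^ 2) • (1 : Matrix (Fin N) (Fin N) ℂ))
    + (S.σnc ^ 2) • (1 : Matrix (Fin N) (Fin N) ℂ)

/-- `B(X) = θ² H_TR X H_TRᴴ + σ_EAP² I`. -/
def B (S : System K N M NT NR) (X : Matrix (Ant NT) (Ant NT) ℂ) : Matrix (Ant NR) (Ant NR) ℂ :=
  (S.θ ^ 2) • (S.HTR * X * S.HTRᴴ) + (S.σEAP ^ 2) • (1 : Matrix (Ant NR) (Ant NR) ℂ)

/-- `g₁(X) = hᴴ A(ρ, X)⁻¹ h`. -/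
def g₁ (S : System K N M NT NR) (X : Matrix (Ant NT) (Ant NT) ℂ) : ℝ :=
  (star S.hST ⬝ᵥ ((S.A X)⁻¹ *ᵥ S.hST)).re

/-- `g₂(X) = hᴴ B(X)⁻¹ h`. -/
def g₂ (S : System K N M NT NR) (X : Matrix (Ant NT) (Ant NT) ℂ) : ℝ :=
  (star S.hEAP ⬝ᵥ ((S.B X)⁻¹ *ᵥ S.hEAP)).re

/-- The gradient matrix of `g₁`. -/
def gradg₁ (S : System K N M NT NR) (X : Matrix (Ant NT) (Ant NT) ℂ) :
    Matrix (Ant NT) (Ant NT) ℂ :=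
  -((1 - S.ρ) • (S.HESᴴ * (S.A X)⁻¹ * Matrix.vecMulVec S.hST (star S.hST) * (S.A X)⁻¹ * S.HES))

/-- The gradient matrix of `g₂`. -/
def gradg₂ (S : System K N M NT NR) (X : Matrix (Ant NT) (Ant NT) ℂ) :
    Matrix (Ant NT) (Ant NT) ℂ :=
  -((S.θ ^ 2) • (S.HTRᴴ * (S.B X)⁻¹ * Matrix.vecMulVec S.hEAP (star S.hEAP) * (S.B X)⁻¹ * S.HTR))

/-- First-slot SINR at a node. -/
def sinr (S : System K N M NT NR) : Node → Matrix (Ant NT) (Ant NT) ℂ → ℝ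
  | .st, X => (1 - S.ρ) * S.Pp * S.g₁ X
  | .eap, X => S.Pp * S.g₂ X

/-- First-order Taylor expansion at `Xb` of the first-slot SINR at a node. -/
def sinrLin (S : System K N M NT NR) :
    Node → Matrix (Ant NT) (Ant NT) ℂ → Matrix (Ant NT) (Ant NT) ℂ → ℝ
  | .st, Xb, X => (1 - S.ρ) * S.Pp * (S.g₁ Xb + (S.gradg₁ Xb * (X - Xb)).trace.re)
  | .eap, Xb, X => S.Pp * (S.g₂ Xb + (S.gradg₂ Xb * (X - Xb)).trace.re)

/-- The power `Tr(H X Hᴴ)` that the ST receives from the EAPs. -/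
def eapPower (S : System K N M NT NR) (X : Matrix (Ant NT) (Ant NT) ℂ) : ℝ :=
  (S.HES * X * S.HESᴴ).trace.re

/-- The total wireless transferred power `P_EH(X)`. -/
def PEH (S : System K N M NT NR) (X : Matrix (Ant NT) (Ant NT) ℂ) : ℝ :=
  S.eapPower X + S.Pp * ∑ i, ‖S.hST i‖ ^ 2

/-- The power `Tr(E_k X)` that the `k`-th EAP transmits in the first slot. -/
def wptPower (_S : System K N M NT NR) (k : Fin K) (X : Matrix (Ant NT) (Ant NT) ℂ) : ℝ :=
  (Matrix.diagonal (fun i : Ant NT => if i.1 = k then (1 : ℂ) else 0) * X).trace.re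

/-- The power `‖v_{p,k}‖²` that the `k`-th EAP transmits in the second slot. -/
def witPower (_S : System K N M NT NR) (k : Fin K) (v : Ant (fun k => NT k + NR k) → ℂ) : ℝ :=
  ∑ j, ‖v ⟨k, j⟩‖ ^ 2

/-- Amplitude `g_spᴴ w + g_EAPᴴ v` of the signal of the PT at the PR. -/
def amp (S : System K N M NT NR) (x : Point N NT NR) : ℂ :=
  star S.gsp ⬝ᵥ x.w + star S.gEAP ⬝ᵥ x.v

/-- Interference plus noise `g_spᴴ Q g_sp + σ_PR²` at the PR. -/
def interf (S : System K N M NT NR) (Q : Matrix (Fin N) (Fin N) ℂ) : ℝ :=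
  (star S.gsp ⬝ᵥ (Q *ᵥ S.gsp)).re + S.σPR ^ 2

/-- Rate of the SR. -/
def rSR (S : System K N M NT NR) (Q : Matrix (Fin N) (Fin N) ℂ) : ℝ :=
  1 / 2 * Real.logb 2
    ((1 : Matrix (Fin M) (Fin M) ℂ) + (S.σSR ^ 2)⁻¹ • (S.Gss * Q * S.Gssᴴ)).det.re

/-- The common objective `½ c₁ log₂(1+t) + c₂ r_SR(Q)`. -/
def obj (S : System K N M NT NR) (x : Point N NT NR) : ℝ :=
  1 / 2 * S.c₁ * Real.logb 2 (1 + x.t) + S.c₂ * S.rSR x.Q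

/-- The inequality constraints `con s i x ≥ 0` of the non-convex subproblem: (P1.1-1) for
`s = st`, (P1.2-1) for `s = eap`. -/
def con (S : System K N M NT NR) (s : Node) : Con K → Point N NT NR → ℝ
  | .wit k, x => S.P0 - S.witPower k x.v
  | .wpt k, x => S.P0 - S.wptPower k x.X
  | .order, x => S.sinr s x.X - S.sinr s.other x.X
  | .first, x => S.sinr s x.X - x.t
  | .second, x => ‖S.amp x‖ ^ 2 / S.interf x.Q - x.t
  | .power, x => S.η * S.ρ * S.PEH x.X - (x.Q.trace.re + ∑ i, ‖x.w i‖ ^ 2)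
  | .cost, x =>
      S.C - (S.c₃ * S.η * S.ρ * S.eapPower x.X + S.c₄ * ‖star S.gEAP ⬝ᵥ x.v‖ ^ 2)
  | .tpos, x => x.t

/-- Feasibility for the non-convex subproblem. -/
structure Feasible (S : System K N M NT NR) (s : Node) (x : Point N NT NR) : Prop where
  ineq : ∀ i, 0 ≤ S.con s i x
  X_psd : x.X.PosSemidef
  Q_psd : x.Q.PosSemidef

/-- The Lagrangian of the non-convex subproblem. -/
def lagrangian (S : System K N M NT NR) (s : Node) (l : Con K → ℝ)
    (Z : Matrix (Ant NT) (Ant NT) ℂ) (W : Matrix (Fin N) (Fin N) ℂ) (x : Point N NT NR) : ℝ :=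
  S.obj x + ∑ k, l (.wit k) * S.con s (.wit k) x + ∑ k, l (.wpt k) * S.con s (.wpt k) x
    + l .order * S.con s .order x + l .first * S.con s .first x
    + l .second * S.con s .second x + l .power * S.con s .power x
    + l .cost * S.con s .cost x + l .tpos * S.con s .tpos x
    + (Z * x.X).trace.re + (W * x.Q).trace.re

/-- The KKT conditions of the non-convex subproblem: primal feasibility, and multipliers that
satisfy dual feasibility, complementary slackness and stationarity of the Lagrangian. Covariance
matrices are Hermitian, so stationarity is along all directions with Hermitian `X`, `Q` parts. -/
def IsKKT (S : System K N M NT NR) (s : Node) (x : Point N NT NR) : Prop :=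
  S.Feasible s x ∧
  ∃ (l : Con K → ℝ) (Z : Matrix (Ant NT) (Ant NT) ℂ) (W : Matrix (Fin N) (Fin N) ℂ),
    (∀ i, 0 ≤ l i) ∧ Z.PosSemidef ∧ W.PosSemidef ∧
    (∀ i, l i * S.con s i x = 0) ∧ (Z * x.X).trace = 0 ∧ (W * x.Q).trace = 0 ∧
    ∀ d : Point N NT NR, d.X.IsHermitian → d.Q.IsHermitian →
      HasDerivAt (fun τ : ℝ => S.lagrangian s l Z W (x.along d τ)) 0 0

/-- The Mangasarian-Fromovitz (Robinson) constraint qualification of the non-convex subproblem: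
some direction points into the interior of both semidefinite cones and strictly increases every
active inequality constraint to first order. -/
def MFCQ (S : System K N M NT NR) (s : Node) (x : Point N NT NR) : Prop :=
  ∃ d : Point N NT NR, (x.X + d.X).PosDef ∧ (x.Q + d.Q).PosDef ∧
    ∀ i, S.con s i x = 0 →
      ∃ m : ℝ, 0 < m ∧ HasDerivAt (fun τ : ℝ => S.con s i (x.along d τ)) m 0

/-- Feasibility of `(x, y)` for the convexified subproblem ((P1.1-1′) for `s = st`, (P1.2-1′) for
`s = eap`) with the linearization point `(Xb, tb, yb)`. -/
structure SurrogateFeasible (S : System K N M NT NR) (s : Node)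
    (Xb : Matrix (Ant NT) (Ant NT) ℂ) (tb yb : ℝ) (x : Point N NT NR) (y : ℝ) : Prop where
  wit : ∀ k, S.witPower k x.v ≤ S.P0
  wpt : ∀ k, S.wptPower k x.X ≤ S.P0
  order : S.sinr s.other x.X ≤ S.sinrLin s Xb x.X
  first : x.t ≤ S.sinrLin s Xb x.X
  interf : S.interf x.Q ≤ y
  second : √(tb * yb) + 1 / 2 * √(yb / tb) * (x.t - tb) + 1 / 2 * √(tb / yb) * (y - yb)
    ≤ (S.amp x).re
  power : x.Q.trace.re + ∑ i, ‖x.w i‖ ^ 2 ≤ S.η * S.ρ * S.PEH x.X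
  cost : S.c₃ * S.η * S.ρ * S.eapPower x.X + S.c₄ * ‖star S.gEAP ⬝ᵥ x.v‖ ^ 2 ≤ S.C
  X_psd : x.X.PosSemidef
  Q_psd : x.Q.PosSemidef
  t_nonneg : 0 ≤ x.t
  y_nonneg : 0 ≤ y

/-- `(x, y)` is an optimal solution of the convexified subproblem. -/
def SurrogateOptimal (S : System K N M NT NR) (s : Node)
    (Xb : Matrix (Ant NT) (Ant NT) ℂ) (tb yb : ℝ) (x : Point N NT NR) (y : ℝ) : Prop :=
  S.SurrogateFeasible s Xb tb yb x y ∧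
    ∀ x' y', S.SurrogateFeasible s Xb tb yb x' y' → S.obj x' ≤ S.obj x

/-- The iterates of the successive convex approximation. The initial iterate solves the feasibility
problem, i.e. it satisfies the constraints of the convexified subproblem for some linearization
point; iterate `n + 1` is an optimal solution of the convexified subproblem linearized at iterate
`n`. The Taylor expansion of `√(t y)` is taken at points with positive `t` and `y`. -/
structure IsSCARun (S : System K N M NT NR) (s : Node) (x : ℕ → Point N NT NR) (y : ℕ → ℝ) :
    Prop where
  init : ∃ (Xb : Matrix (Ant NT) (Ant NT) ℂ) (tb yb : ℝ), Xb.PosSemidef ∧ 0 < tb ∧ 0 < yb ∧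
    S.SurrogateFeasible s Xb tb yb (x 0) (y 0)
  step : ∀ n, S.SurrogateOptimal s (x n).X (x n).t (y n) (x (n + 1)) (y (n + 1))
  t_pos : ∀ n, 0 < (x n).t

end System

end CCRN

end

/-! Each SINR is a quadratic form in the inverse of a matrix affine in `X`, hence convex on the
semidefinite cone and above its tangents, while `√(t y)` is concave and below its tangents. So every
convexified problem is an inner approximation of the non-convex one (`SurrogateFeasible.feasible`),
and the approximation is tight at the linearization point. An iterate is therefore feasible for the
problem linearized at itself (`SurrogateFeasible.self`), and the optimum of that problem is at least
as good: the objective is monotone. The power budgets bound the feasible set, so accumulation points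
exist. They are feasible by continuity, and a monotone sequence with a convergent subsequence
converges.

For the KKT conditions, suppose that at an accumulation point `a` some direction enters the interior
of both cones, strictly increases the active constraints to first order, and also increases the
objective. A short step along it, followed by a common phase rotation of `w` and `v`, is strictly
feasible in the linearized constraints of the problem at the limiting linearization point. These
constraints depend continuously on that point, so the step stays feasible for the problems solved
late in the subsequence. The next iterate would then exceed the limit of the objective, a
contradiction (`IsSCARun.no_ascent`). The auxiliary `y` need not converge, but a further subsequence
of it does, because `t` stays away from zero.

The absence of such directions, together with the constraint qualification, yields multipliers by
separating the open positive orthant from a convex image (`exists_multipliers`). The semidefinite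
multipliers represent the remaining linear functional on each matrix block
(`exists_posSemidef_repr`). If the ordering constraint is inactive, the qualification holds
automatically: shrinking all powers and lowering `t` relaxes every other active constraint
(`Admissible.mfcq_of_order_pos`). -/

noncomputable section

namespace CCRN

/-! ### Entrywise differentiability of matrix functions, with no choice of matrix norm. -/

section EntryDiff

variable {E : Type*} [NormedAddCommGroup E] [NormedSpace ℝ E] {l m n : Type*} {a : E}

/-- All entries of the matrix function `F` are differentiable at `a`. -/
def EntryDiffAt (F : E → Matrix m n ℂ) (a : E) : Prop :=
  ∀ i j, DifferentiableAt ℝ (fun p => F p i j) a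

theorem EntryDiffAt.const (F : Matrix m n ℂ) : EntryDiffAt (fun _ : E => F) a :=
  fun _ _ => differentiableAt_const _

theorem EntryDiffAt.add {F G : E → Matrix m n ℂ} (hF : EntryDiffAt F a) (hG : EntryDiffAt G a) :
    EntryDiffAt (fun p => F p + G p) a :=
  fun i j => (hF i j).add (hG i j)

theorem EntryDiffAt.sub {F G : E → Matrix m n ℂ} (hF : EntryDiffAt F a) (hG : EntryDiffAt G a) :
    EntryDiffAt (fun p => F p - G p) a :=
  fun i j => (hF i j).sub (hG i j)

theorem EntryDiffAt.smul {F : E → Matrix m n ℂ} (c : ℝ) (hF : EntryDiffAt F a) :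
    EntryDiffAt (fun p => c • F p) a :=
  fun i j => (hF i j).const_smul c

theorem EntryDiffAt.mul [Fintype m] {F : E → Matrix l m ℂ} {G : E → Matrix m n ℂ}
    (hF : EntryDiffAt F a) (hG : EntryDiffAt G a) : EntryDiffAt (fun p => F p * G p) a := by
  intro i j
  simp only [Matrix.mul_apply]
  exact DifferentiableAt.fun_sum fun k _ => (hF i k).mul (hG k j)

theorem EntryDiffAt.det [Fintype n] [DecidableEq n] {F : E → Matrix n n ℂ}
    (hF : EntryDiffAt F a) : DifferentiableAt ℝ (fun p => (F p).det) a := by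
  simp only [Matrix.det_apply]
  refine DifferentiableAt.fun_sum fun σ _ => ?_
  simp only [Units.smul_def]
  simp only [zsmul_eq_mul]
  exact (HasFDerivAt.finsetProd fun i _ =>
    (hF (σ i) i).hasFDerivAt).differentiableAt.const_mul _

/-- By Cramer's rule each entry of the inverse is a determinant in the entries of `F` or constants,
divided by `det F`. -/
theorem EntryDiffAt.inv [Fintype n] [DecidableEq n] {F : E → Matrix n n ℂ}
    (hF : EntryDiffAt F a) (h : (F a).det ≠ 0) : EntryDiffAt (fun p => (F p)⁻¹) a := by
  intro i j
  simp only [Matrix.inv_def, Ring.inverse_eq_inv', Matrix.smul_apply, Matrix.adjugate_apply,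
    smul_eq_mul]
  refine (hF.det.inv h).mul (EntryDiffAt.det fun i' j' => ?_)
  simp only [Matrix.updateRow_apply]
  split_ifs
  · exact differentiableAt_const _
  · exact hF _ _

theorem EntryDiffAt.trace [Fintype n] {F : E → Matrix n n ℂ}
    (hF : EntryDiffAt F a) : DifferentiableAt ℝ (fun p => (F p).trace) a :=
  DifferentiableAt.fun_sum fun i _ => hF i i

theorem EntryDiffAt.dotProduct_mulVec [Fintype m] [Fintype n] {F : E → Matrix m n ℂ}
    (hF : EntryDiffAt F a) (u : m → ℂ) (v : n → ℂ) :
    DifferentiableAt ℝ (fun p => u ⬝ᵥ (F p *ᵥ v)) a :=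
  DifferentiableAt.fun_sum fun i _ =>
    (DifferentiableAt.fun_sum fun j _ => (hF i j).mul_const (v j)).const_mul (u i)

end EntryDiff

theorem differentiableAt_re {E : Type*} [NormedAddCommGroup E] [NormedSpace ℝ E] {a : E}
    {f : E → ℂ} (hf : DifferentiableAt ℝ f a) : DifferentiableAt ℝ (fun p => (f p).re) a :=
  Complex.reCLM.differentiableAt.comp a hf

/-! ### The affine matrix family common to both SINRs. -/

section AffMat

variable {m n : Type*} [Fintype m] [DecidableEq n]

/-- The matrix `α H X Hᴴ + β I`. -/
def affMat (H : Matrix n m ℂ) (α β : ℝ) (X : Matrix m m ℂ) : Matrix n n ℂ :=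
  α • (H * X * Hᴴ) + β • (1 : Matrix n n ℂ)

theorem affMat_add (H : Matrix n m ℂ) (α β : ℝ) (X D : Matrix m m ℂ) :
    affMat H α β (X + D) = affMat H α β X + α • (H * D * Hᴴ) := by
  simp only [affMat, Matrix.mul_add, Matrix.add_mul, smul_add]; abel

theorem EntryDiffAt.affMat {E : Type*} [NormedAddCommGroup E] [NormedSpace ℝ E] {a : E}
    {F : E → Matrix m m ℂ} (hF : EntryDiffAt F a) (H : Matrix n m ℂ)
    (α β : ℝ) : EntryDiffAt (fun p => affMat H α β (F p)) a :=
  ((((EntryDiffAt.const H).mul hF).mul (EntryDiffAt.const _)).smul α).add (EntryDiffAt.const _)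

end AffMat

/-! ### Semidefinite matrices and convexity of inverse quadratic forms. -/

section PSD

variable {m n : Type*} [Fintype m] [Fintype n]

/-- With `X = Bᴴ B`, an entry is an inner product of two columns of `B`. By the arithmetic-geometric
mean inequality it is at most the average of two diagonal entries, each of which is at most the
trace. -/
theorem norm_entry_le_trace [DecidableEq n] {X : Matrix n n ℂ} (hX : X.PosSemidef) (i j : n) :
    ‖X i j‖ ≤ X.trace.re := by
  obtain ⟨B, rfl⟩ : ∃ B : Matrix n n ℂ, X = Bᴴ * B := by
    open scoped MatrixOrder in
    exact CStarAlgebra.nonneg_iff_eq_star_mul_self.mp (Matrix.nonneg_iff_posSemidef.mpr hX)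
  have hd : ∀ i, ((Bᴴ * B) i i).re = ∑ k, ‖B k i‖ ^ 2 := by
    intro i
    simp only [Matrix.mul_apply, Matrix.conjTranspose_apply, Complex.re_sum]
    refine Finset.sum_congr rfl fun k _ => ?_
    rw [← Complex.normSq_eq_norm_sq, Complex.star_def, Complex.normSq_apply]
    simp
  have hle : ∀ i, ∑ k, ‖B k i‖ ^ 2 ≤ (Bᴴ * B).trace.re := by
    intro i
    rw [Matrix.trace, Complex.re_sum, ← hd i]
    refine Finset.single_le_sum (f := fun i => ((Bᴴ * B).diag i).re) (fun k _ => ?_)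
      (Finset.mem_univ i)
    change 0 ≤ ((Bᴴ * B) k k).re
    rw [hd]; positivity
  have h1 : ‖(Bᴴ * B) i j‖ ≤ ∑ k, (‖B k i‖ ^ 2 + ‖B k j‖ ^ 2) / 2 := by
    simp only [Matrix.mul_apply, Matrix.conjTranspose_apply]
    refine (norm_sum_le _ _).trans (Finset.sum_le_sum fun k _ => ?_)
    rw [norm_mul, norm_star]
    nlinarith [sq_nonneg (‖B k i‖ - ‖B k j‖)]
  rw [← Finset.sum_div, Finset.sum_add_distrib] at h1
  linarith [hle i, hle j]

theorem PosSemidef.re_trace_nonneg {X : Matrix n n ℂ} (hX : X.PosSemidef) : 0 ≤ X.trace.re :=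
  (Complex.le_def.mp hX.trace_nonneg).1

theorem PosSemidef.re_quad_nonneg {X : Matrix n n ℂ} (hX : X.PosSemidef) (u : n → ℂ) :
    0 ≤ (star u ⬝ᵥ (X *ᵥ u)).re :=
  (Complex.le_def.mp (hX.dotProduct_mulVec_nonneg u)).1

theorem PosSemidef.congr_conj {X : Matrix m m ℂ} (hX : X.PosSemidef) (H : Matrix n m ℂ) :
    (H * X * Hᴴ).PosSemidef :=
  hX.mul_mul_conjTranspose_same H

variable [DecidableEq n]

theorem posDef_affMat (H : Matrix n m ℂ) {α β : ℝ} (hα : 0 ≤ α) (hβ : 0 < β)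
    {X : Matrix m m ℂ} (hX : X.PosSemidef) : (affMat H α β X).PosDef :=
  Matrix.PosDef.posSemidef_add ((PosSemidef.congr_conj hX H).smul hα) (Matrix.PosDef.one.smul hβ)

/-- `hᴴ (α H X Hᴴ + β I)⁻¹ h`. -/
def invQuad (H : Matrix n m ℂ) (h : n → ℂ) (α β : ℝ) (X : Matrix m m ℂ) : ℝ :=
  (star h ⬝ᵥ ((affMat H α β X)⁻¹ *ᵥ h)).re

/-- The directional derivative of `invQuad` at `X`. -/
def invQuadDeriv (H : Matrix n m ℂ) (h : n → ℂ) (α β : ℝ) (X D : Matrix m m ℂ) : ℝ :=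
  -(star h ⬝ᵥ (((affMat H α β X)⁻¹ * (α • (H * D * Hᴴ)) * (affMat H α β X)⁻¹) *ᵥ h)).re

/-- A matrix-inverse quadratic form lies above its tangent. -/
theorem quad_inv_tangent_le {A B : Matrix n n ℂ} (hA : A.PosDef) (hB : B.PosDef) (h : n → ℂ) :
    (star h ⬝ᵥ (A⁻¹ *ᵥ h)).re - (star h ⬝ᵥ ((A⁻¹ * (B - A) * A⁻¹) *ᵥ h)).re
      ≤ (star h ⬝ᵥ (B⁻¹ *ᵥ h)).re := by
  have hAu := (Matrix.isUnit_iff_isUnit_det A).mp hA.isUnit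
  have hBu := (Matrix.isUnit_iff_isUnit_det B).mp hB.isUnit
  have hP : ((B⁻¹ - A⁻¹)ᴴ * B * (B⁻¹ - A⁻¹)).PosSemidef :=
    hB.posSemidef.conjTranspose_mul_mul_same _
  have hAi : (A⁻¹)ᴴ = A⁻¹ := hA.inv.isHermitian
  have hBi : (B⁻¹)ᴴ = B⁻¹ := hB.inv.isHermitian
  -- The gap between the inverse and its tangent is exactly this congruence of `B`, hence
  -- semidefinite.
  have hexp : (B⁻¹ - A⁻¹)ᴴ * B * (B⁻¹ - A⁻¹) = B⁻¹ - A⁻¹ + A⁻¹ * (B - A) * A⁻¹ := by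
    rw [Matrix.conjTranspose_sub, hAi, hBi]
    simp only [Matrix.sub_mul, Matrix.mul_sub, Matrix.nonsing_inv_mul _ hAu,
      Matrix.nonsing_inv_mul _ hBu, Matrix.one_mul, Matrix.mul_assoc, Matrix.mul_nonsing_inv _ hBu,
      Matrix.mul_one]
    abel
  have := PosSemidef.re_quad_nonneg hP h
  rw [hexp, Matrix.add_mulVec, Matrix.sub_mulVec, dotProduct_add, dotProduct_sub,
    Complex.add_re, Complex.sub_re] at this
  linarith

theorem invQuad_tangent_le (H : Matrix n m ℂ) (h : n → ℂ) {α β : ℝ} (hα : 0 ≤ α) (hβ : 0 < β)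
    {Y X : Matrix m m ℂ} (hY : Y.PosSemidef) (hX : X.PosSemidef) :
    invQuad H h α β Y + invQuadDeriv H h α β Y (X - Y) ≤ invQuad H h α β X := by
  have := quad_inv_tangent_le (posDef_affMat H hα hβ hY) (posDef_affMat H hα hβ hX) h
  have e : affMat H α β X - affMat H α β Y = α • (H * (X - Y) * Hᴴ) := by
    rw [← add_sub_cancel Y X, affMat_add]; simp
  rw [e] at this
  exact this

/-- The tangent at `X`, evaluated at `0`, already lies above the value at `X`, because the
derivative in direction `-X` is nonnegative. This is what bounds `t` on the feasible set. -/
theorem invQuad_le_zero (H : Matrix n m ℂ) (h : n → ℂ) {α β : ℝ} (hα : 0 ≤ α) (hβ : 0 < β)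
    {X : Matrix m m ℂ} (hX : X.PosSemidef) : invQuad H h α β X ≤ invQuad H h α β 0 := by
  have h1 := invQuad_tangent_le H h hα hβ hX Matrix.PosSemidef.zero
  have hAi : ((affMat H α β X)⁻¹)ᴴ = (affMat H α β X)⁻¹ :=
    (posDef_affMat H hα hβ hX).inv.isHermitian
  have hP : ((affMat H α β X)⁻¹ * (α • (H * X * Hᴴ)) * (affMat H α β X)⁻¹).PosSemidef := by
    have := ((PosSemidef.congr_conj hX H).smul hα).mul_mul_conjTranspose_same (affMat H α β X)⁻¹
    rwa [hAi] at this
  have h2 := PosSemidef.re_quad_nonneg hP h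
  have h3 : invQuadDeriv H h α β X (0 - X)
      = (star h ⬝ᵥ (((affMat H α β X)⁻¹ * (α • (H * X * Hᴴ)) * (affMat H α β X)⁻¹) *ᵥ h)).re := by
    simp [invQuadDeriv, Matrix.neg_mulVec]
  linarith

section Diff

variable {E : Type*} [NormedAddCommGroup E] [NormedSpace ℝ E] {a : E}

theorem EntryDiffAt.invQuad {F : E → Matrix m m ℂ} (hF : EntryDiffAt F a) (H : Matrix n m ℂ)
    (h : n → ℂ) {α β : ℝ} (hd : (CCRN.affMat H α β (F a)).det ≠ 0) :
    DifferentiableAt ℝ (fun p => invQuad H h α β (F p)) a :=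
  differentiableAt_re (((hF.affMat H α β).inv hd).dotProduct_mulVec _ _)

theorem EntryDiffAt.invQuadDeriv {F G : E → Matrix m m ℂ} (hF : EntryDiffAt F a)
    (hG : EntryDiffAt G a) (H : Matrix n m ℂ)
    (h : n → ℂ) {α β : ℝ} (hd : (CCRN.affMat H α β (F a)).det ≠ 0) :
    DifferentiableAt ℝ (fun p => invQuadDeriv H h α β (F p) (G p)) a :=
  (differentiableAt_re (((((hF.affMat H α β).inv hd).mul
    ((((EntryDiffAt.const H).mul hG).mul (EntryDiffAt.const _)).smul α)).mul
    ((hF.affMat H α β).inv hd)).dotProduct_mulVec _ _)).neg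

end Diff

theorem hasDerivAt_invQuad (H : Matrix n m ℂ) (h : n → ℂ) {α β : ℝ} {X : Matrix m m ℂ}
    (hd : (affMat H α β X).det ≠ 0) (D : Matrix m m ℂ) :
    HasDerivAt (fun τ : ℝ => invQuad H h α β (X + τ • D)) (invQuadDeriv H h α β X D) 0 := by
  have hL : EntryDiffAt (fun τ : ℝ => X + τ • D) 0 := fun i j => by
    simp only [Matrix.add_apply, Matrix.smul_apply]
    fun_prop
  have hM := hL.affMat H α β
  have h0 : (affMat H α β (X + (0 : ℝ) • D)).det ≠ 0 := by simpa using hd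
  have hI := hM.inv h0
  -- By the resolvent identity the function equals `invQuad H h α β X + τ * r τ` near `0`, so its
  -- derivative there is `r 0`.
  let r : ℝ → ℝ := fun τ => -(star h ⬝ᵥ (((affMat H α β (X + τ • D))⁻¹ * (α • (H * D * Hᴴ)) *
    (affMat H α β X)⁻¹) *ᵥ h)).re
  have hr : DifferentiableAt ℝ r 0 :=
    (differentiableAt_re (((hI.mul (EntryDiffAt.const _)).mul
      (EntryDiffAt.const _)).dotProduct_mulVec _ _)).neg
  have hder : HasDerivAt (fun τ : ℝ => invQuad H h α β X + τ * r τ) (r 0) 0 := by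
    simpa using ((hasDerivAt_id (0 : ℝ)).mul hr.hasDerivAt).const_add (invQuad H h α β X)
  have hr0 : r 0 = invQuadDeriv H h α β X D := by simp [r, invQuadDeriv]
  rw [hr0] at hder
  refine hder.congr_of_eventuallyEq ?_
  have hne : ∀ᶠ τ : ℝ in 𝓝 0, (affMat H α β (X + τ • D)).det ≠ 0 :=
    hM.det.continuousAt.eventually_ne h0
  filter_upwards [hne] with τ hτ
  have hu1 := isUnit_iff_ne_zero.mpr hτ
  have hu0 := isUnit_iff_ne_zero.mpr hd
  have key : (affMat H α β (X + τ • D))⁻¹ = (affMat H α β X)⁻¹ -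
      τ • ((affMat H α β (X + τ • D))⁻¹ * (α • (H * D * Hᴴ)) * (affMat H α β X)⁻¹) := by
    have e : τ • (α • (H * D * Hᴴ)) = affMat H α β (X + τ • D) - affMat H α β X := by
      rw [affMat_add]; simp [smul_comm τ α]
    rw [← Matrix.smul_mul, ← Matrix.mul_smul, e, Matrix.mul_sub, Matrix.sub_mul,
      Matrix.nonsing_inv_mul _ hu1, Matrix.one_mul, Matrix.mul_assoc, Matrix.mul_nonsing_inv _ hu0,
      Matrix.mul_one]
    abel
  unfold invQuad
  rw [key]
  simp only [r, Matrix.sub_mulVec, dotProduct_sub, Complex.sub_re, Matrix.smul_mulVec,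
    dotProduct_smul, Complex.smul_re, smul_eq_mul]
  ring

end PSD

/-! ### First-order positivity and separation. -/

/-- A function that is nonnegative at `0`, with positive derivative if it vanishes there, is positive
right of `0`. -/
theorem eventually_pos_of_hasDerivAt {f : ℝ → ℝ} {m : ℝ} (hf : HasDerivAt f m 0) (h0 : 0 ≤ f 0)
    (hm : f 0 = 0 → 0 < m) : ∀ᶠ τ in 𝓝[>] (0 : ℝ), 0 < f τ := by
  rcases h0.lt_or_eq with h | h
  · exact (hf.continuousAt.eventually (lt_mem_nhds h)).filter_mono nhdsWithin_le_nhds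
  · have hs := (hasDerivAt_iff_tendsto_slope.mp hf).mono_left
      (nhdsWithin_mono (0 : ℝ) (fun τ (hτ : 0 < τ) => hτ.ne') : 𝓝[>] (0 : ℝ) ≤ 𝓝[≠] 0)
    filter_upwards [hs.eventually (lt_mem_nhds (hm h.symm)), self_mem_nhdsWithin] with τ hτ hpos
    rw [slope_def_field, ← h, sub_zero, sub_zero] at hτ
    exact (div_pos_iff_of_pos_right hpos).mp hτ

/-- Multipliers for a system of linear inequalities on a convex set under a Slater condition. -/
theorem exists_multipliers {V ι : Type*} [AddCommGroup V] [Module ℝ V] [Fintype ι] {U : Set V}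
    (hU : Convex ℝ U) (f₀ : V →ₗ[ℝ] ℝ) (f : ι → V →ₗ[ℝ] ℝ)
    (hno : ∀ d ∈ U, (∀ i, 0 < f i d) → f₀ d ≤ 0) (hsl : ∃ d ∈ U, ∀ i, 0 < f i d) :
    ∃ l : ι → ℝ, (∀ i, 0 ≤ l i) ∧ ∀ d ∈ U, f₀ d + ∑ i, l i * f i d ≤ 0 := by
  classical
  let L : V →ₗ[ℝ] (Option ι → ℝ) := LinearMap.pi fun o => o.elim f₀ f
  let O : Set (Option ι → ℝ) := {z | ∀ o, 0 < z o}
  have hOo : IsOpen O := by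
    have : O = ⋂ o, {z : Option ι → ℝ | 0 < z o} := by ext; simp [O]
    rw [this]
    exact isOpen_iInter_of_finite fun o => isOpen_lt continuous_const (continuous_apply o)
  have hOc : Convex ℝ O := by
    intro x hx y hy a b ha hb hab o
    have h1 := hx o
    have h2 := hy o
    simp only [Pi.add_apply, Pi.smul_apply, smul_eq_mul]
    rcases ha.lt_or_eq with ha' | ha'
    · have := mul_pos ha' h1; have := mul_nonneg hb h2.le; linarith
    · have hb1 : b = 1 := by linarith
      rw [← ha', hb1]; linarith
  -- A common point would be a direction that increases the objective and all the constraints.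
  have hdis : Disjoint O (L '' U) := by
    rw [Set.disjoint_left]
    rintro z hz ⟨d, hd, rfl⟩
    exact absurd (hno d hd fun i => hz (some i)) (not_le.mpr (hz none))
  obtain ⟨g, u, hgO, hgU⟩ := geometric_hahn_banach_open hOc hOo (hU.linear_image L) hdis
  let c : Option ι → ℝ := fun o => -g (Pi.single o 1)
  have hg : ∀ z, g z = -∑ o, c o * z o := by
    intro z
    conv_lhs => rw [← Finset.univ_sum_single z]
    rw [map_sum, ← Finset.sum_neg_distrib]
    refine Finset.sum_congr rfl fun o _ => ?_
    have : (Pi.single o (z o) : Option ι → ℝ) = z o • Pi.single o 1 := by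
      rw [← Pi.single_smul]; simp
    rw [this, map_smul]; simp [c]; ring
  -- The separating bound passes from the open orthant to its closure.
  have hclos : ∀ z : Option ι → ℝ, (∀ o, 0 ≤ z o) → g z ≤ u := by
    intro z hz
    have ht : Tendsto (fun ε : ℝ => g (z + fun _ => ε)) (𝓝[>] 0) (𝓝 (g z)) := by
      have : Continuous fun ε : ℝ => g (z + fun _ => ε) := by fun_prop
      have h := this.tendsto 0
      have e : (z + fun _ => (0 : ℝ)) = z := by ext; simp
      rw [e] at h
      exact h.mono_left nhdsWithin_le_nhds
    refine le_of_tendsto ht ?_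
    filter_upwards [self_mem_nhdsWithin] with ε hε
    exact (hgO _ fun o => add_pos_of_nonneg_of_pos (hz o) hε).le
  have hu : 0 ≤ u := by simpa using hclos 0 fun _ => le_rfl
  have hc : ∀ o, 0 ≤ c o := by
    intro o
    by_contra! hneg
    -- If `c o` were negative, this multiple of the basis vector would give `g` the value `u + 1`.
    have h := hclos (((u + 1) / (-c o)) • Pi.single o 1) fun o' => by
      have : 0 ≤ (u + 1) / (-c o) := by apply div_nonneg <;> linarith
      rw [Pi.smul_apply, smul_eq_mul]
      refine mul_nonneg this ?_
      by_cases hh : o' = o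
      · subst hh; simp
      · simp [hh]
    rw [map_smul, smul_eq_mul] at h
    have e : g (Pi.single o 1) = -c o := by simp [c]
    rw [e, div_mul_cancel₀ _ (by linarith : -c o ≠ 0)] at h
    linarith
  have hle : ∀ d ∈ U, c none * f₀ d + ∑ i, c (some i) * f i d ≤ -u := by
    intro d hd
    have h := hgU (L d) ⟨d, hd, rfl⟩
    rw [hg, Fintype.sum_option] at h
    simp only [L, LinearMap.pi_apply, Option.elim] at h
    linarith
  -- If the objective had weight zero, the Slater direction would force all weights to vanish and `u
  -- ≤ 0`, whereas strict separation on the open orthant would give `0 < u`.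
  have hpos : 0 < c none := by
    refine (hc none).lt_of_ne fun h0 => ?_
    obtain ⟨d, hd, hdp⟩ := hsl
    have h := hle d hd
    rw [← h0, zero_mul, zero_add] at h
    have hnn : ∀ i ∈ Finset.univ, 0 ≤ c (some i) * f i d :=
      fun i _ => mul_nonneg (hc _) (hdp i).le
    have hs := Finset.sum_nonneg hnn
    have hz := (Finset.sum_eq_zero_iff_of_nonneg hnn).mp (by linarith)
    have hz' : ∀ i, c (some i) = 0 := fun i =>
      (mul_eq_zero.mp (hz i (Finset.mem_univ i))).resolve_right (hdp i).ne'
    have h1 := hgO (fun _ => 1) fun _ => one_pos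
    rw [hg, Fintype.sum_option] at h1
    simp [hz', ← h0] at h1
    linarith
  refine ⟨fun i => c (some i) / c none, fun i => div_nonneg (hc _) hpos.le, fun d hd => ?_⟩
  have h := hle d hd
  have e : f₀ d + ∑ i, c (some i) / c none * f i d
      = (c none * f₀ d + ∑ i, c (some i) * f i d) / c none := by
    rw [add_div, mul_div_cancel_left₀ _ hpos.ne', Finset.sum_div]
    congr 1
    exact Finset.sum_congr rfl fun i _ => by ring
  rw [e]
  exact div_nonpos_of_nonpos_of_nonneg (by linarith) hpos.le

/-- The trace of a product of two Hermitian matrices is real. -/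
theorem trace_mul_eq_zero_of_re {n : Type*} [Fintype n] {Z X : Matrix n n ℂ} (hZ : Z.IsHermitian) (hX : X.IsHermitian)
    (h : (Z * X).trace.re = 0) : (Z * X).trace = 0 := by
  refine Complex.ext h ?_
  have : star (Z * X).trace = (Z * X).trace := by
    rw [← Matrix.trace_conjTranspose, Matrix.conjTranspose_mul, hZ.eq, hX.eq, Matrix.trace_mul_comm]
  simpa using Complex.conj_eq_iff_im.mp this

/-! ### Semidefinite representation of functionals on Hermitian matrices. -/

section Representation

variable {n : Type*} [Fintype n] [DecidableEq n]

/-- Hermitian part of the `(i, j)` matrix unit. -/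
def symUnit (i j : n) : Matrix n n ℂ :=
  (1 / 2 : ℝ) • (Matrix.single i j 1 + Matrix.single j i 1)

/-- Hermitian part of `I` times the `(i, j)` matrix unit. -/
def skewUnit (i j : n) : Matrix n n ℂ :=
  (1 / 2 : ℝ) • (Matrix.single i j Complex.I - Matrix.single j i Complex.I)

/-- Averaging the entrywise expansions of `D` and `Dᴴ` leaves real coefficients, so a real-linear
functional is determined on Hermitian matrices by its values on these units. -/
theorem isHermitian_eq_sum_units {D : Matrix n n ℂ} (hD : D.IsHermitian) :
    D = ∑ i, ∑ j, ((D i j).re • symUnit i j + (D i j).im • skewUnit i j) := by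
  have h1 : D = ∑ i, ∑ j, Matrix.single i j (D i j) := Matrix.matrix_eq_sum_single D
  have h2 : D = ∑ i, ∑ j, Matrix.single j i (star (D i j)) := by
    conv_lhs => rw [← hD.eq, h1]
    simp [Matrix.conjTranspose_sum, Matrix.conjTranspose_single]
  have h3 : D = (1 / 2 : ℝ) • (∑ i, ∑ j, Matrix.single i j (D i j)
      + ∑ i, ∑ j, Matrix.single j i (star (D i j))) := by
    rw [← h1, ← h2, ← two_smul ℝ D, smul_smul]; norm_num
  conv_lhs => rw [h3]
  simp only [← Finset.sum_add_distrib, Finset.smul_sum]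
  refine Finset.sum_congr rfl fun i _ => Finset.sum_congr rfl fun j _ => ?_
  have e1 : ∀ (i j : n) (z : ℂ), Matrix.single i j z
      = z.re • Matrix.single i j (1 : ℂ) + z.im • Matrix.single i j Complex.I := by
    intro i j z
    rw [Matrix.smul_single, Matrix.smul_single, ← Matrix.single_add]
    congr 1
    simp [Complex.re_add_im]
  rw [e1 i j (D i j), e1 j i (star (D i j))]
  simp only [symUnit, skewUnit, Complex.star_def, Complex.conj_re, Complex.conj_im]
  module

/-- A real functional that is nonpositive on positive semidefinite matrices is represented on
Hermitian matrices by a positive semidefinite matrix. -/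
theorem exists_posSemidef_repr (G : Matrix n n ℂ →ₗ[ℝ] ℝ)
    (hG : ∀ P : Matrix n n ℂ, P.PosSemidef → G P ≤ 0) :
    ∃ Z : Matrix n n ℂ, Z.PosSemidef ∧
      ∀ D : Matrix n n ℂ, D.IsHermitian → G D + (Z * D).trace.re = 0 := by
  -- The transposed indices match `Tr(Z D) = ∑ Z j i * D i j`; the signs differ because the real
  -- part of a product subtracts the product of imaginary parts.
  let Z : Matrix n n ℂ := Matrix.of fun j i => ⟨-G (symUnit i j), G (skewUnit i j)⟩
  have hZ : ∀ D : Matrix n n ℂ, D.IsHermitian → G D + (Z * D).trace.re = 0 := by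
    intro D hD
    have : G D = ∑ i, ∑ j, ((D i j).re * G (symUnit i j) + (D i j).im * G (skewUnit i j)) := by
      conv_lhs => rw [isHermitian_eq_sum_units hD]
      simp [map_sum]
    rw [this]
    simp only [Matrix.trace, Matrix.diag, Matrix.mul_apply, Complex.re_sum]
    rw [Finset.sum_comm, ← Finset.sum_add_distrib]
    refine Finset.sum_eq_zero fun j _ => ?_
    rw [← Finset.sum_add_distrib]
    refine Finset.sum_eq_zero fun i _ => ?_
    simp only [Z, Matrix.of_apply, Complex.mul_re]
    ring
  have hH : Z.IsHermitian := by
    ext i j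
    have hs : symUnit i j = symUnit j i := by simp only [symUnit, add_comm]
    have hk : skewUnit i j = -skewUnit j i := by
      simp only [skewUnit, ← smul_neg, neg_sub]
    simp only [Matrix.conjTranspose_apply, Z, Matrix.of_apply, Complex.star_def]
    apply Complex.ext
    · simp [hs]
    · simp [hk]
  refine ⟨Z, Matrix.PosSemidef.of_dotProduct_mulVec_nonneg hH fun u => ?_, hZ⟩
  -- Rank-one matrices turn the sign condition on `G` into nonnegativity of the quadratic form of
  -- `Z`.
  have hP : (Matrix.vecMulVec u (star u)).PosSemidef := Matrix.posSemidef_vecMulVec_self_star u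
  have h1 := hZ _ hP.isHermitian
  have h2 := hG _ hP
  have h3 : (Z * Matrix.vecMulVec u (star u)).trace = star u ⬝ᵥ (Z *ᵥ u) := by
    rw [Matrix.mul_vecMulVec, Matrix.trace_vecMulVec, dotProduct_comm]
  rw [h3] at h1
  rw [Complex.le_def]
  refine ⟨by simp; linarith, ?_⟩
  have := hH.im_star_dotProduct_mulVec_self u
  simpa using this.symm

end Representation

/-! ### The tangent of `√(t y)` -/

/-- The geometric mean is homogeneous of degree one, so by Euler's identity its tangent has no
constant term. -/
theorem geomMean_tangent_eq {tb yb : ℝ} (htb : 0 < tb) (hyb : 0 < yb) (t y : ℝ) :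
    √(tb * yb) + 1 / 2 * √(yb / tb) * (t - tb) + 1 / 2 * √(tb / yb) * (y - yb)
      = 1 / 2 * (√yb / √tb) * t + 1 / 2 * (√tb / √yb) * y := by
  rw [Real.sqrt_mul htb.le, Real.sqrt_div hyb.le, Real.sqrt_div htb.le]
  have hp := Real.sqrt_pos.mpr htb
  have hq := Real.sqrt_pos.mpr hyb
  have e1 : √tb ^ 2 = tb := Real.sq_sqrt htb.le
  have e2 : √yb ^ 2 = yb := Real.sq_sqrt hyb.le
  have h1 : √yb / √tb * tb = √tb * √yb := by
    rw [div_mul_eq_mul_div, div_eq_iff hp.ne']; rw [← e1]; simp; ring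
  have h2 : √tb / √yb * yb = √tb * √yb := by
    rw [div_mul_eq_mul_div, div_eq_iff hq.ne']; rw [← e2]; simp; ring
  linear_combination (-1 / 2) * h1 + (-1 / 2) * h2

theorem geomMean_tangent_self (tb yb : ℝ) :
    √(tb * yb) + 1 / 2 * √(yb / tb) * (tb - tb) + 1 / 2 * √(tb / yb) * (yb - yb)
      = √(tb * yb) := by
  simp

theorem geomMean_le_tangent {tb yb t y : ℝ} (htb : 0 < tb) (hyb : 0 < yb) (ht : 0 ≤ t)
    (hy : 0 ≤ y) :
    √(t * y) ≤ √(tb * yb) + 1 / 2 * √(yb / tb) * (t - tb) + 1 / 2 * √(tb / yb) * (y - yb) := by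
  rw [geomMean_tangent_eq htb hyb, Real.sqrt_mul ht]
  have hp := Real.sqrt_pos.mpr htb
  have hq := Real.sqrt_pos.mpr hyb
  have e1 : √t ^ 2 = t := Real.sq_sqrt ht
  have e2 : √y ^ 2 = y := Real.sq_sqrt hy
  have key : ∀ b c : ℝ, 1 / 2 * (√yb / √tb) * b ^ 2 + 1 / 2 * (√tb / √yb) * c ^ 2 - b * c
      = (b * √yb - c * √tb) ^ 2 / (2 * √tb * √yb) := by
    intro b c
    field_simp
    ring
  have key := key √t √y
  rw [e1, e2] at key
  have : 0 ≤ (√t * √yb - √y * √tb) ^ 2 / (2 * √tb * √yb) := by positivity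
  linarith

variable {K N M : ℕ} {NT NR : Fin K → ℕ}

/-! ### Coordinates -/

/-- The points as a normed space. -/
abbrev Coords {K : ℕ} (N : ℕ) (NT NR : Fin K → ℕ) : Type :=
  (Ant NT → Ant NT → ℂ) × (Fin N → Fin N → ℂ) × (Fin N → ℂ) ×
    (Ant (fun k => NT k + NR k) → ℂ) × ℝ

/-- The point with given coordinates. -/
def Point.ofCoords (p : Coords N NT NR) : Point N NT NR where
  X := p.1
  Q := p.2.1
  w := p.2.2.1
  v := p.2.2.2.1
  t := p.2.2.2.2

/-- The coordinates of a point. -/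
def Point.coords (x : Point N NT NR) : Coords N NT NR := (x.X, x.Q, x.w, x.v, x.t)

theorem Point.coords_add (x z : Point N NT NR) : x.coords + z.coords =
    Point.coords ⟨x.X + z.X, x.Q + z.Q, x.w + z.w, x.v + z.v, x.t + z.t⟩ := rfl

theorem Point.coords_smul (c : ℝ) (x : Point N NT NR) : c • x.coords =
    Point.coords ⟨c • x.X, c • x.Q, c • x.w, c • x.v, c * x.t⟩ := rfl

theorem Point.coords_neg (x : Point N NT NR) : -x.coords =
    Point.coords ⟨-x.X, -x.Q, -x.w, -x.v, -x.t⟩ := rfl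

theorem Point.convergesTo_iff {x : ℕ → Point N NT NR} {a : Point N NT NR} :
    Point.ConvergesTo x a ↔ Tendsto (fun n => (x n).coords) atTop (𝓝 a.coords) := by
  constructor
  · intro h
    exact h.X.prodMk_nhds (h.Q.prodMk_nhds (h.w.prodMk_nhds (h.v.prodMk_nhds h.t)))
  · intro h
    have h2 := (continuous_snd.tendsto _).comp h
    have h3 := (continuous_snd.tendsto _).comp h2
    have h4 := (continuous_snd.tendsto _).comp h3
    exact ⟨(continuous_fst.tendsto _).comp h, (continuous_fst.tendsto _).comp h2,
      (continuous_fst.tendsto _).comp h3, (continuous_fst.tendsto _).comp h4,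
      (continuous_snd.tendsto _).comp h4⟩

theorem Point.hasDerivAt_along {f : Point N NT NR → ℝ} {a : Point N NT NR}
    (hf : DifferentiableAt ℝ (fun p => f (Point.ofCoords p)) a.coords) (d : Point N NT NR) :
    HasDerivAt (fun τ : ℝ => f (a.along d τ))
      (fderiv ℝ (fun p => f (Point.ofCoords p)) a.coords d.coords) 0 :=
  hf.hasFDerivAt.hasLineDerivAt d.coords

theorem Point.along_zero (x d : Point N NT NR) : x.along d 0 = x := by
  simp [Point.along]

theorem entryDiffAt_X (a : Coords N NT NR) :
    EntryDiffAt (fun p : Coords N NT NR => (Point.ofCoords p).X) a := fun i j => by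
  change DifferentiableAt ℝ (fun p : Coords N NT NR => p.1 i j) a
  fun_prop

theorem entryDiffAt_Q (a : Coords N NT NR) :
    EntryDiffAt (fun p : Coords N NT NR => (Point.ofCoords p).Q) a := fun i j => by
  change DifferentiableAt ℝ (fun p : Coords N NT NR => p.2.1 i j) a
  fun_prop

theorem differentiableAt_w (a : Coords N NT NR) (i : Fin N) :
    DifferentiableAt ℝ (fun p : Coords N NT NR => (Point.ofCoords p).w i) a := by
  change DifferentiableAt ℝ (fun p : Coords N NT NR => p.2.2.1 i) a
  fun_prop

theorem differentiableAt_v (a : Coords N NT NR) (i : Ant (fun k => NT k + NR k)) :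
    DifferentiableAt ℝ (fun p : Coords N NT NR => (Point.ofCoords p).v i) a := by
  change DifferentiableAt ℝ (fun p : Coords N NT NR => p.2.2.2.1 i) a
  fun_prop

theorem differentiableAt_t (a : Coords N NT NR) :
    DifferentiableAt ℝ (fun p : Coords N NT NR => (Point.ofCoords p).t) a := by
  change DifferentiableAt ℝ (fun p : Coords N NT NR => p.2.2.2.2) a
  fun_prop

theorem differentiableAt_normSq {E : Type*} [NormedAddCommGroup E] [NormedSpace ℝ E] {a : E}
    {f : E → ℂ} (hf : DifferentiableAt ℝ f a) : DifferentiableAt ℝ (fun p => ‖f p‖ ^ 2) a :=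
  hf.norm_sq ℝ

namespace System

variable (S : System K N M NT NR)

/-! ### The first-slot SINR -/

theorem A_eq_affMat (X : Matrix (Ant NT) (Ant NT) ℂ) :
    S.A X = affMat S.HES (1 - S.ρ) ((1 - S.ρ) * S.σna ^ 2 + S.σnc ^ 2) X := by
  simp only [A, affMat]; module

theorem B_eq_affMat (X : Matrix (Ant NT) (Ant NT) ℂ) :
    S.B X = affMat S.HTR (S.θ ^ 2) (S.σEAP ^ 2) X := rfl

theorem g₁_eq_invQuad (X : Matrix (Ant NT) (Ant NT) ℂ) :
    S.g₁ X = invQuad S.HES S.hST (1 - S.ρ) ((1 - S.ρ) * S.σna ^ 2 + S.σnc ^ 2) X := by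
  rw [g₁, A_eq_affMat, invQuad]

theorem g₂_eq_invQuad (X : Matrix (Ant NT) (Ant NT) ℂ) :
    S.g₂ X = invQuad S.HTR S.hEAP (S.θ ^ 2) (S.σEAP ^ 2) X := rfl

/-- Cyclicity of the trace moves the rank-one factor to the end, where the trace becomes a quadratic
form. -/
theorem trace_grad_eq_invQuadDeriv {m n : Type*} [Fintype m] [Fintype n] [DecidableEq n]
    (H : Matrix n m ℂ) (h : n → ℂ) (α β : ℝ) (X D : Matrix m m ℂ) :
    (-(α • (Hᴴ * (affMat H α β X)⁻¹ * Matrix.vecMulVec h (star h) * (affMat H α β X)⁻¹ * H))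
      * D).trace.re = invQuadDeriv H h α β X D := by
  set R := (affMat H α β X)⁻¹
  have e : (Hᴴ * R * Matrix.vecMulVec h (star h) * R * H * D).trace
      = star h ⬝ᵥ ((R * (H * D * Hᴴ) * R) *ᵥ h) := by
    rw [show Hᴴ * R * Matrix.vecMulVec h (star h) * R * H * D
      = (Hᴴ * R) * (Matrix.vecMulVec h (star h) * (R * H * D)) by simp only [Matrix.mul_assoc],
      Matrix.trace_mul_comm,
      show Matrix.vecMulVec h (star h) * (R * H * D) * (Hᴴ * R)
        = Matrix.vecMulVec h (star h) * (R * (H * D * Hᴴ) * R) by simp only [Matrix.mul_assoc],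
      Matrix.trace_mul_comm, Matrix.mul_vecMulVec, Matrix.trace_vecMulVec, dotProduct_comm]
  rw [Matrix.neg_mul, Matrix.smul_mul, Matrix.trace_neg, Matrix.trace_smul, e, invQuadDeriv]
  simp only [Matrix.mul_smul, Matrix.smul_mul, Matrix.smul_mulVec, dotProduct_smul,
    Complex.neg_re, R]

/-- The directional derivative of the first-slot SINR. -/
def sinrDeriv (s : Node) (X D : Matrix (Ant NT) (Ant NT) ℂ) : ℝ :=
  match s with
  | .st => (1 - S.ρ) * S.Pp *
      invQuadDeriv S.HES S.hST (1 - S.ρ) ((1 - S.ρ) * S.σna ^ 2 + S.σnc ^ 2) X D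
  | .eap => S.Pp * invQuadDeriv S.HTR S.hEAP (S.θ ^ 2) (S.σEAP ^ 2) X D

theorem sinrLin_eq (s : Node) (Xb X : Matrix (Ant NT) (Ant NT) ℂ) :
    S.sinrLin s Xb X = S.sinr s Xb + S.sinrDeriv s Xb (X - Xb) := by
  cases s with
  | st =>
    simp only [sinrLin, sinr, sinrDeriv, gradg₁, A_eq_affMat, trace_grad_eq_invQuadDeriv]
    ring
  | eap =>
    simp only [sinrLin, sinr, sinrDeriv, gradg₂, B_eq_affMat, trace_grad_eq_invQuadDeriv]
    ring

theorem sinrDeriv_smul (s : Node) (X D : Matrix (Ant NT) (Ant NT) ℂ) (τ : ℝ) :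
    S.sinrDeriv s X (τ • D) = τ * S.sinrDeriv s X D := by
  cases s <;>
  · simp only [sinrDeriv, invQuadDeriv, Matrix.mul_smul, Matrix.smul_mul, smul_comm _ τ,
      Matrix.smul_mulVec, dotProduct_smul, Complex.smul_re, smul_eq_mul]
    ring

theorem sinrLin_self (s : Node) (X : Matrix (Ant NT) (Ant NT) ℂ) :
    S.sinrLin s X X = S.sinr s X := by
  have := S.sinrDeriv_smul s X 0 0
  rw [sinrLin_eq, sub_self]
  simp only [zero_mul, smul_zero] at this
  rw [this, add_zero]

variable {S}

theorem Admissible.noise_pos (hS : S.Admissible) :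
    0 < (1 - S.ρ) * S.σna ^ 2 + S.σnc ^ 2 := by
  have h1 := hS.σnc_pos
  have h2 : 0 ≤ 1 - S.ρ := by linarith [hS.ρ_le_one]
  positivity

theorem Admissible.one_sub_ρ_nonneg (hS : S.Admissible) : 0 ≤ 1 - S.ρ := by
  linarith [hS.ρ_le_one]

theorem Admissible.σEAP_sq_pos (hS : S.Admissible) : 0 < S.σEAP ^ 2 := by
  have := hS.σEAP_pos
  positivity

theorem Admissible.sinrLin_le (hS : S.Admissible) (s : Node) {Xb X : Matrix (Ant NT) (Ant NT) ℂ}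
    (hXb : Xb.PosSemidef) (hX : X.PosSemidef) : S.sinrLin s Xb X ≤ S.sinr s X := by
  have hP := hS.Pp_pos.le
  have hρ := hS.one_sub_ρ_nonneg
  rw [sinrLin_eq]
  cases s with
  | st =>
    simp only [sinr, sinrDeriv, g₁_eq_invQuad, ← mul_add]
    exact mul_le_mul_of_nonneg_left (invQuad_tangent_le _ _ hρ hS.noise_pos hXb hX)
      (mul_nonneg hρ hP)
  | eap =>
    simp only [sinr, sinrDeriv, g₂_eq_invQuad, ← mul_add]
    exact mul_le_mul_of_nonneg_left
      (invQuad_tangent_le _ _ (sq_nonneg _) hS.σEAP_sq_pos hXb hX) hP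

theorem Admissible.sinr_le_zero (hS : S.Admissible) (s : Node) {X : Matrix (Ant NT) (Ant NT) ℂ}
    (hX : X.PosSemidef) : S.sinr s X ≤ S.sinr s 0 := by
  have hP := hS.Pp_pos.le
  have hρ := hS.one_sub_ρ_nonneg
  cases s with
  | st =>
    simp only [sinr, g₁_eq_invQuad]
    exact mul_le_mul_of_nonneg_left (invQuad_le_zero _ _ hρ hS.noise_pos hX) (mul_nonneg hρ hP)
  | eap =>
    simp only [sinr, g₂_eq_invQuad]
    exact mul_le_mul_of_nonneg_left (invQuad_le_zero _ _ (sq_nonneg _) hS.σEAP_sq_pos hX) hP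

theorem Admissible.det_st_ne_zero (hS : S.Admissible) {X : Matrix (Ant NT) (Ant NT) ℂ}
    (hX : X.PosSemidef) :
    (affMat S.HES (1 - S.ρ) ((1 - S.ρ) * S.σna ^ 2 + S.σnc ^ 2) X).det ≠ 0 :=
  (posDef_affMat _ hS.one_sub_ρ_nonneg hS.noise_pos hX).det_pos.ne'

theorem Admissible.det_eap_ne_zero (hS : S.Admissible) {X : Matrix (Ant NT) (Ant NT) ℂ}
    (hX : X.PosSemidef) : (affMat S.HTR (S.θ ^ 2) (S.σEAP ^ 2) X).det ≠ 0 :=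
  (posDef_affMat _ (sq_nonneg _) hS.σEAP_sq_pos hX).det_pos.ne'

theorem Admissible.hasDerivAt_sinr (hS : S.Admissible) (s : Node)
    {X : Matrix (Ant NT) (Ant NT) ℂ} (hX : X.PosSemidef) (D : Matrix (Ant NT) (Ant NT) ℂ) :
    HasDerivAt (fun τ : ℝ => S.sinr s (X + τ • D)) (S.sinrDeriv s X D) 0 := by
  cases s with
  | st =>
    simp only [sinr, g₁_eq_invQuad]
    exact (hasDerivAt_invQuad _ _ (hS.det_st_ne_zero hX) D).const_mul _
  | eap =>
    simp only [sinr, g₂_eq_invQuad]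
    exact (hasDerivAt_invQuad _ _ (hS.det_eap_ne_zero hX) D).const_mul _

theorem hasDerivAt_sinrLin (s : Node) (X D : Matrix (Ant NT) (Ant NT) ℂ) :
    HasDerivAt (fun τ : ℝ => S.sinrLin s X (X + τ • D)) (S.sinrDeriv s X D) 0 := by
  simp only [sinrLin_eq, add_sub_cancel_left, sinrDeriv_smul]
  simpa using ((hasDerivAt_id (0 : ℝ)).mul_const (S.sinrDeriv s X D)).const_add (S.sinr s X)

theorem Admissible.differentiableAt_sinr (hS : S.Admissible) (s : Node) {E : Type*}
    [NormedAddCommGroup E] [NormedSpace ℝ E] {a : E} {F : E → Matrix (Ant NT) (Ant NT) ℂ}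
    (hF : EntryDiffAt F a) (hX : (F a).PosSemidef) :
    DifferentiableAt ℝ (fun p => S.sinr s (F p)) a := by
  cases s with
  | st =>
    simp only [sinr, g₁_eq_invQuad]
    exact (hF.invQuad _ _ (hS.det_st_ne_zero hX)).const_mul _
  | eap =>
    simp only [sinr, g₂_eq_invQuad]
    exact (hF.invQuad _ _ (hS.det_eap_ne_zero hX)).const_mul _

/-- Differentiability of the linearized SINR in the linearization point. -/
theorem Admissible.differentiableAt_sinrLin (hS : S.Admissible) (s : Node) {E : Type*}
    [NormedAddCommGroup E] [NormedSpace ℝ E] {a : E} {F : E → Matrix (Ant NT) (Ant NT) ℂ}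
    (hF : EntryDiffAt F a) (hX : (F a).PosSemidef) (X' : Matrix (Ant NT) (Ant NT) ℂ) :
    DifferentiableAt ℝ (fun p => S.sinrLin s (F p) X') a := by
  have hG : EntryDiffAt (fun p => X' - F p) a := (EntryDiffAt.const X').sub hF
  simp only [sinrLin_eq]
  refine (hS.differentiableAt_sinr s hF hX).add ?_
  cases s with
  | st => exact (hF.invQuadDeriv hG _ _ (hS.det_st_ne_zero hX)).const_mul _
  | eap => exact (hF.invQuadDeriv hG _ _ (hS.det_eap_ne_zero hX)).const_mul _

/-! ### Differentiability of the objective and of the constraints -/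

theorem Admissible.interf_pos (hS : S.Admissible) {Q : Matrix (Fin N) (Fin N) ℂ}
    (hQ : Q.PosSemidef) : 0 < S.interf Q := by
  have h1 := hS.σPR_pos
  have h2 := PosSemidef.re_quad_nonneg hQ S.gsp
  unfold interf
  positivity

theorem rSR_det_pos {Q : Matrix (Fin N) (Fin N) ℂ}
    (hQ : Q.PosSemidef) :
    0 < ((1 : Matrix (Fin M) (Fin M) ℂ) + (S.σSR ^ 2)⁻¹ • (S.Gss * Q * S.Gssᴴ)).det.re := by
  have h : ((1 : Matrix (Fin M) (Fin M) ℂ) + (S.σSR ^ 2)⁻¹ • (S.Gss * Q * S.Gssᴴ)).PosDef :=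
    Matrix.PosDef.one.add_posSemidef ((PosSemidef.congr_conj hQ S.Gss).smul (by positivity))
  exact (Complex.lt_def.mp h.det_pos).1

theorem differentiableAt_eapPower (a : Coords N NT NR) :
    DifferentiableAt ℝ (fun p : Coords N NT NR => S.eapPower (Point.ofCoords p).X) a :=
  differentiableAt_re (((EntryDiffAt.const _).mul (entryDiffAt_X a)).mul
    (EntryDiffAt.const _)).trace

theorem differentiableAt_amp (a : Coords N NT NR) :
    DifferentiableAt ℝ (fun p : Coords N NT NR => S.amp (Point.ofCoords p)) a :=
  (DifferentiableAt.fun_sum fun i _ => (differentiableAt_w a i).const_mul _).add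
    (DifferentiableAt.fun_sum fun i _ => (differentiableAt_v a i).const_mul _)

theorem differentiableAt_interf (a : Coords N NT NR) :
    DifferentiableAt ℝ (fun p : Coords N NT NR => S.interf (Point.ofCoords p).Q) a :=
  (differentiableAt_re ((entryDiffAt_Q a).dotProduct_mulVec _ _)).add_const _

theorem Admissible.differentiableAt_con (hS : S.Admissible) (s : Node) {a : Point N NT NR}
    (hX : a.X.PosSemidef) (hQ : a.Q.PosSemidef) (i : Con K) :
    DifferentiableAt ℝ (fun p => S.con s i (Point.ofCoords p)) a.coords := by
  have hs := fun s => hS.differentiableAt_sinr s (entryDiffAt_X a.coords) hX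
  have ht := differentiableAt_t a.coords
  cases i with
  | wit k =>
    exact (DifferentiableAt.fun_sum fun i _ =>
      differentiableAt_normSq (differentiableAt_v a.coords _)).const_sub _
  | wpt k =>
    exact (differentiableAt_re
      ((EntryDiffAt.const _).mul (entryDiffAt_X a.coords)).trace).const_sub _
  | order => exact (hs _).sub (hs _)
  | first => exact (hs _).sub ht
  | second =>
    have h1 : DifferentiableAt ℝ (fun p => (S.interf (Point.ofCoords p).Q)⁻¹) a.coords :=
      (differentiableAt_interf _).fun_inv (hS.interf_pos hQ).ne'
    simp only [con, div_eq_mul_inv]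
    exact ((differentiableAt_normSq (differentiableAt_amp _)).mul h1).sub ht
  | power =>
    exact (((differentiableAt_eapPower _).add_const _).const_mul _).sub
      ((differentiableAt_re (entryDiffAt_Q _).trace).add
        (DifferentiableAt.fun_sum fun i _ =>
          differentiableAt_normSq (differentiableAt_w a.coords _)))
  | cost =>
    exact (((differentiableAt_eapPower _).const_mul _).add
      ((differentiableAt_normSq (DifferentiableAt.fun_sum fun i _ =>
        (differentiableAt_v a.coords i).const_mul _)).const_mul _)).const_sub _
  | tpos => exact ht

theorem differentiableAt_obj {a : Point N NT NR}
    (hQ : a.Q.PosSemidef) (ht : 0 ≤ a.t) :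
    DifferentiableAt ℝ (fun p => S.obj (Point.ofCoords p)) a.coords := by
  have h1 : DifferentiableAt ℝ (fun p : Coords N NT NR => Real.log (1 + (Point.ofCoords p).t))
      a.coords :=
    ((differentiableAt_t a.coords).const_add 1).log (by linarith : 0 < 1 + a.t).ne'
  have h2 : DifferentiableAt ℝ (fun p : Coords N NT NR =>
      Real.log ((1 : Matrix (Fin M) (Fin M) ℂ) +
        (S.σSR ^ 2)⁻¹ • (S.Gss * (Point.ofCoords p).Q * S.Gssᴴ)).det.re) a.coords :=
    (differentiableAt_re ((EntryDiffAt.const _).add ((((EntryDiffAt.const _).mul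
      (entryDiffAt_Q _)).mul (EntryDiffAt.const _)).smul _)).det).log (rSR_det_pos hQ).ne'
  simp only [obj, rSR, Real.logb, div_eq_mul_inv]
  exact ((h1.mul_const _).const_mul _).add (((h2.mul_const _).const_mul _).const_mul _)

end System

theorem Point.bounded_coords {x : Point N NT NR} {R : ℝ} (hR : 0 ≤ R) (h : x.BoundedBy R) :
    x.coords ∈ Metric.closedBall (0 : Coords N NT NR) R := by
  rw [mem_closedBall_zero_iff]
  refine max_le ?_ (max_le ?_ (max_le ?_ (max_le ?_ ?_)))
  · exact (pi_norm_le_iff_of_nonneg hR).mpr fun i => (pi_norm_le_iff_of_nonneg hR).mpr (h.X i)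
  · exact (pi_norm_le_iff_of_nonneg hR).mpr fun i => (pi_norm_le_iff_of_nonneg hR).mpr (h.Q i)
  · exact (pi_norm_le_iff_of_nonneg hR).mpr h.w
  · exact (pi_norm_le_iff_of_nonneg hR).mpr h.v
  · exact h.t

theorem Point.ConvergesTo.tendsto {F : Type*} [NormedAddCommGroup F] [NormedSpace ℝ F]
    {x : ℕ → Point N NT NR} {a : Point N NT NR} (ha : Point.ConvergesTo x a)
    {f : Point N NT NR → F}
    (hf : DifferentiableAt ℝ (fun p => f (Point.ofCoords p)) a.coords) :
    Tendsto (fun n => f (x n)) atTop (𝓝 (f a)) :=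
  hf.continuousAt.tendsto.comp (Point.convergesTo_iff.mp ha)

namespace System

variable {S : System K N M NT NR} {s : Node}

/-! ### Feasible points of the convexified subproblem -/

section Surrogate

variable {Xb : Matrix (Ant NT) (Ant NT) ℂ} {tb yb : ℝ} {x : Point N NT NR} {y : ℝ}

theorem SurrogateFeasible.y_pos (hS : S.Admissible) (h : S.SurrogateFeasible s Xb tb yb x y) :
    0 < y :=
  (hS.interf_pos h.Q_psd).trans_le h.interf

theorem SurrogateFeasible.sqrt_le_amp (htb : 0 < tb) (hyb : 0 < yb)
    (h : S.SurrogateFeasible s Xb tb yb x y) : √(x.t * y) ≤ (S.amp x).re :=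
  (geomMean_le_tangent htb hyb h.t_nonneg h.y_nonneg).trans h.second

/-- Relinearizing at the point itself makes the approximations exact there, and the old ones were
only more restrictive. This gives the monotonicity of the objective. -/
theorem SurrogateFeasible.self (hS : S.Admissible) (hXb : Xb.PosSemidef) (htb : 0 < tb)
    (hyb : 0 < yb) (h : S.SurrogateFeasible s Xb tb yb x y) :
    S.SurrogateFeasible s x.X x.t y x y where
  wit := h.wit
  wpt := h.wpt
  order := by
    rw [sinrLin_self]
    exact h.order.trans (hS.sinrLin_le s hXb h.X_psd)
  first := by
    rw [sinrLin_self]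
    exact h.first.trans (hS.sinrLin_le s hXb h.X_psd)
  interf := h.interf
  second := by
    rw [geomMean_tangent_self]
    exact h.sqrt_le_amp htb hyb
  power := h.power
  cost := h.cost
  X_psd := h.X_psd
  Q_psd := h.Q_psd
  t_nonneg := h.t_nonneg
  y_nonneg := h.y_nonneg

/-- The tangents err on the safe side. For the amplitude, `t * interf ≤ t * y ≤ ‖amp‖ ^ 2`. -/
theorem SurrogateFeasible.feasible (hS : S.Admissible) (hXb : Xb.PosSemidef) (htb : 0 < tb)
    (hyb : 0 < yb) (h : S.SurrogateFeasible s Xb tb yb x y) : S.Feasible s x where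
  ineq i := by
    cases i with
    | wit k => exact sub_nonneg.mpr (h.wit k)
    | wpt k => exact sub_nonneg.mpr (h.wpt k)
    | order => exact sub_nonneg.mpr (h.order.trans (hS.sinrLin_le s hXb h.X_psd))
    | first => exact sub_nonneg.mpr (h.first.trans (hS.sinrLin_le s hXb h.X_psd))
    | second =>
      refine sub_nonneg.mpr ((le_div_iff₀ (hS.interf_pos h.Q_psd)).mpr ?_)
      have h1 : √(x.t * y) ≤ ‖S.amp x‖ := (h.sqrt_le_amp htb hyb).trans (Complex.re_le_norm _)
      have h2 : x.t * y ≤ ‖S.amp x‖ ^ 2 := by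
        rw [← Real.sq_sqrt (mul_nonneg h.t_nonneg h.y_nonneg)]
        exact pow_le_pow_left₀ (Real.sqrt_nonneg _) h1 2
      exact (mul_le_mul_of_nonneg_left h.interf h.t_nonneg).trans h2
    | power => exact sub_nonneg.mpr h.power
    | cost => exact sub_nonneg.mpr h.cost
    | tpos => exact h.t_nonneg
  X_psd := h.X_psd
  Q_psd := h.Q_psd

end Surrogate

/-! ### Feasibility and monotonicity along the run. -/

section Run

variable {x : ℕ → Point N NT NR} {y : ℕ → ℝ}

/-- A step of the run does not assert that its linearization point is semidefinite with positive
`y`; both come from the feasibility of the preceding iterate. -/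
theorem IsSCARun.surrogateFeasible (hS : S.Admissible) (hrun : S.IsSCARun s x y) (n : ℕ) :
    ∃ (Xb : Matrix (Ant NT) (Ant NT) ℂ) (tb yb : ℝ), Xb.PosSemidef ∧ 0 < tb ∧ 0 < yb ∧
      S.SurrogateFeasible s Xb tb yb (x n) (y n) := by
  induction n with
  | zero => exact hrun.init
  | succ n ih =>
    obtain ⟨Xb, tb, yb, -, -, -, h⟩ := ih
    exact ⟨_, _, _, h.X_psd, hrun.t_pos n, h.y_pos hS, (hrun.step n).1⟩

theorem IsSCARun.feasible (hS : S.Admissible) (hrun : S.IsSCARun s x y) (n : ℕ) :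
    S.Feasible s (x n) := by
  obtain ⟨Xb, tb, yb, h1, h2, h3, h⟩ := hrun.surrogateFeasible hS n
  exact h.feasible hS h1 h2 h3

theorem IsSCARun.obj_le_succ (hS : S.Admissible) (hrun : S.IsSCARun s x y) (n : ℕ) :
    S.obj (x n) ≤ S.obj (x (n + 1)) := by
  obtain ⟨Xb, tb, yb, h1, h2, h3, h⟩ := hrun.surrogateFeasible hS n
  exact (hrun.step n).2 _ _ (h.self hS h1 h2 h3)

end Run

/-! ### Boundedness of the feasible set -/

theorem trace_re_eq_sum_wptPower (X : Matrix (Ant NT) (Ant NT) ℂ) :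
    X.trace.re = ∑ k, S.wptPower k X := by
  have h : ∀ k, S.wptPower k X = ∑ i : Ant NT, if i.1 = k then (X i i).re else 0 := by
    intro k
    simp only [wptPower, Matrix.trace, Matrix.diag, Matrix.diagonal_mul, Complex.re_sum, ite_mul,
      one_mul, zero_mul]
    exact Finset.sum_congr rfl fun i _ => by split_ifs <;> simp
  simp only [h]
  rw [Finset.sum_comm]
  simp [Matrix.trace]

theorem exists_eapPower_le (R : ℝ) :
    ∃ B : ℝ, ∀ X : Matrix (Ant NT) (Ant NT) ℂ, (∀ i j, ‖X i j‖ ≤ R) → S.eapPower X ≤ B := by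
  refine ⟨∑ i, ∑ j, ∑ k, ‖S.HES i k‖ * R * ‖S.HESᴴ j i‖, fun X hX => ?_⟩
  refine (Complex.re_le_norm _).trans ?_
  simp only [Matrix.trace, Matrix.diag, Matrix.mul_apply, Finset.sum_mul]
  refine (norm_sum_le _ _).trans (Finset.sum_le_sum fun i _ => ?_)
  refine (norm_sum_le _ _).trans (Finset.sum_le_sum fun j _ => ?_)
  refine (norm_sum_le _ _).trans (Finset.sum_le_sum fun k _ => ?_)
  rw [norm_mul, norm_mul]
  gcongr
  exact hX k j

/-- The per-node budgets bound the trace of `X` and the blocks of `v`. Bounded `X` bounds the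
harvested power, hence `Q` and `w`. Finally `t` is at most the SINR, which is largest without
interference, at `X = 0`. -/
theorem Admissible.exists_bound (hS : S.Admissible) (s : Node) :
    ∃ R : ℝ, 0 ≤ R ∧ ∀ x : Point N NT NR, S.Feasible s x → x.BoundedBy R := by
  have hP0 := hS.P0_pos
  have hηρ : 0 ≤ S.η * S.ρ := mul_nonneg hS.η_pos.le hS.ρ_nonneg
  obtain ⟨B, hB⟩ := S.exists_eapPower_le (K * S.P0)
  set T : ℝ := S.η * S.ρ * (|B| + S.Pp * ∑ i, ‖S.hST i‖ ^ 2) with hT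
  have hT0 : 0 ≤ T := by have := hS.Pp_pos; positivity
  have hKP : 0 ≤ K * S.P0 := by positivity
  have hσ : 0 ≤ |S.sinr s 0| := abs_nonneg _
  -- A crude bound that avoids square roots; it explains the `+ 1` terms in the radius.
  have sq_bound : ∀ {u b : ℝ}, 0 ≤ b → u ^ 2 ≤ b → u ≤ b + 1 := by
    intro u b hb hu
    nlinarith [sq_nonneg (u - 1)]
  refine ⟨K * S.P0 + (S.P0 + 1) + (T + 1) + |S.sinr s 0|, by positivity, fun x hx => ?_⟩
  have hX : ∀ i j, ‖x.X i j‖ ≤ K * S.P0 := by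
    intro i j
    refine (norm_entry_le_trace hx.X_psd i j).trans ?_
    rw [S.trace_re_eq_sum_wptPower]
    calc ∑ k, S.wptPower k x.X ≤ ∑ _k : Fin K, S.P0 :=
          Finset.sum_le_sum fun k _ => sub_nonneg.mp (hx.ineq (.wpt k))
      _ = K * S.P0 := by simp
  have hpow : x.Q.trace.re + ∑ i, ‖x.w i‖ ^ 2 ≤ T := by
    refine (sub_nonneg.mp (hx.ineq .power)).trans (mul_le_mul_of_nonneg_left ?_ hηρ)
    exact add_le_add_left ((hB _ hX).trans (le_abs_self B)) _
  have hQ0 := PosSemidef.re_trace_nonneg hx.Q_psd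
  have hw0 : 0 ≤ ∑ i, ‖x.w i‖ ^ 2 := by positivity
  constructor
  · intro i j
    linarith [hX i j]
  · intro i j
    linarith [norm_entry_le_trace hx.Q_psd i j]
  · intro i
    have : ‖x.w i‖ ^ 2 ≤ ∑ i, ‖x.w i‖ ^ 2 :=
      Finset.single_le_sum (f := fun i => ‖x.w i‖ ^ 2) (fun _ _ => by positivity)
        (Finset.mem_univ i)
    linarith [sq_bound hT0 (this.trans (by linarith))]
  · rintro ⟨k, j⟩
    have : ‖x.v ⟨k, j⟩‖ ^ 2 ≤ S.witPower k x.v :=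
      Finset.single_le_sum (f := fun j => ‖x.v ⟨k, j⟩‖ ^ 2) (fun _ _ => by positivity)
        (Finset.mem_univ j)
    linarith [sq_bound hP0.le (this.trans (sub_nonneg.mp (hx.ineq (.wit k))))]
  · have h0 : 0 ≤ x.t := hx.ineq .tpos
    have h1 : x.t ≤ S.sinr s x.X := sub_nonneg.mp (hx.ineq .first)
    have h2 := hS.sinr_le_zero s hx.X_psd
    rw [abs_of_nonneg h0]
    linarith [le_abs_self (S.sinr s 0)]

/-! ### Accumulation points -/

theorem isClosed_posSemidef {n : Type*} [Fintype n] :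
    IsClosed {X : Matrix n n ℂ | X.PosSemidef} := by
  have : {X : Matrix n n ℂ | X.PosSemidef}
      = {X | Xᴴ = X} ∩ ⋂ u : n → ℂ, {X | 0 ≤ star u ⬝ᵥ (X *ᵥ u)} := by
    ext X
    simp only [Set.mem_ofPred_eq, Set.mem_inter_iff, Set.mem_iInter]
    exact Matrix.posSemidef_iff_dotProduct_mulVec
  rw [this]
  refine IsClosed.inter (isClosed_eq (by fun_prop) continuous_id) (isClosed_iInter fun u => ?_)
  exact isClosed_le continuous_const (by fun_prop)

/-- Closedness of the cones comes first, since the continuity of the constraints is available at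
points with semidefinite `X` and `Q`. -/
theorem Admissible.feasible_of_tendsto (hS : S.Admissible) {x : ℕ → Point N NT NR}
    {a : Point N NT NR} (hx : ∀ n, S.Feasible s (x n)) (ha : Point.ConvergesTo x a) :
    S.Feasible s a := by
  have hX : a.X.PosSemidef :=
    isClosed_posSemidef.mem_of_tendsto ha.X (Eventually.of_forall fun n => (hx n).X_psd)
  have hQ : a.Q.PosSemidef :=
    isClosed_posSemidef.mem_of_tendsto ha.Q (Eventually.of_forall fun n => (hx n).Q_psd)
  refine ⟨fun i => ?_, hX, hQ⟩
  exact ge_of_tendsto' (ha.tendsto (f := S.con s i) (hS.differentiableAt_con s hX hQ i)) fun n => (hx n).ineq i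

theorem tendsto_obj {x : ℕ → Point N NT NR} {a : Point N NT NR} (hfa : S.Feasible s a)
    (ha : Point.ConvergesTo x a) : Tendsto (fun n => S.obj (x n)) atTop (𝓝 (S.obj a)) :=
  ha.tendsto (f := S.obj) (S.differentiableAt_obj hfa.Q_psd (hfa.ineq .tpos))

theorem exists_accumulation {x : ℕ → Point N NT NR} {R : ℝ} (hR : 0 ≤ R)
    (hx : ∀ n, (x n).BoundedBy R) :
    ∃ (a : Point N NT NR) (φ : ℕ → ℕ), StrictMono φ ∧
      Point.ConvergesTo (fun j => x (φ j)) a := by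
  obtain ⟨p, -, φ, hφ, hp⟩ := (isCompact_closedBall (0 : Coords N NT NR) R).tendsto_subseq
    fun n => Point.bounded_coords hR (hx n)
  exact ⟨Point.ofCoords p, φ, hφ, Point.convergesTo_iff.mpr hp⟩

/-- The auxiliary variable has a limit along a further subsequence. -/
theorem IsSCARun.exists_tendsto_aux (hS : S.Admissible) {x : ℕ → Point N NT NR} {y : ℕ → ℝ}
    (hrun : S.IsSCARun s x y) {a : Point N NT NR} {φ : ℕ → ℕ}
    (ha : Point.ConvergesTo (fun j => x (φ j)) a) (ht : 0 < a.t) :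
    ∃ (ψ : ℕ → ℕ) (ys : ℝ), StrictMono ψ ∧ Tendsto (fun j => y (φ (ψ j))) atTop (𝓝 ys) ∧
      S.interf a.Q ≤ ys ∧ √(a.t * ys) ≤ (S.amp a).re := by
  have hamp : Tendsto (fun j => (S.amp (x (φ j))).re) atTop (𝓝 (S.amp a).re) :=
    (Complex.continuous_re.tendsto _).comp
      (ha.tendsto (f := S.amp) (differentiableAt_amp (S := S) a.coords))
  have hint : Tendsto (fun j => S.interf (x (φ j)).Q) atTop (𝓝 (S.interf a.Q)) :=
    ha.tendsto (f := fun x => S.interf x.Q) (differentiableAt_interf (S := S) a.coords)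
  have hsf : ∀ n, √((x n).t * y n) ≤ (S.amp (x n)).re ∧ S.interf (x n).Q ≤ y n ∧ 0 < y n := by
    intro n
    obtain ⟨Xb, tb, yb, -, h2, h3, h⟩ := hrun.surrogateFeasible hS n
    exact ⟨h.sqrt_le_amp h2 h3, h.interf, h.y_pos hS⟩
  -- Along the subsequence this bound converges, as `a.t` is positive, so the auxiliary variables
  -- stay in a compact interval.
  have hle : ∀ n, y n ≤ (S.amp (x n)).re ^ 2 / (x n).t := by
    intro n
    obtain ⟨h1, -, h3⟩ := hsf n
    rw [le_div_iff₀ (hrun.t_pos n), mul_comm]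
    rw [← Real.sq_sqrt (mul_pos (hrun.t_pos n) h3).le]
    exact pow_le_pow_left₀ (Real.sqrt_nonneg _) h1 2
  obtain ⟨C, hC⟩ := ((hamp.pow 2).div ha.t ht.ne').bddAbove_range
  obtain ⟨ys, -, ψ, hψ, hys⟩ := (isCompact_Icc (a := (0 : ℝ)) (b := C)).tendsto_subseq
    (x := fun j => y (φ j))
    fun j => ⟨(hsf _).2.2.le, (hle _).trans (hC ⟨j, rfl⟩)⟩
  have hψt := hψ.tendsto_atTop
  refine ⟨ψ, ys, hψ, hys, ?_, ?_⟩
  · exact le_of_tendsto_of_tendsto' (hint.comp hψt) hys fun j => (hsf _).2.1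
  · exact le_of_tendsto_of_tendsto' ((Real.continuous_sqrt.tendsto _).comp
      ((ha.t.comp hψt).mul hys)) (hamp.comp hψt) fun j => (hsf _).1

/-- Strictly feasible points remain feasible under perturbations of the linearization point. -/
theorem SurrogateFeasible.eventually (hS : S.Admissible) {Xb : Matrix (Ant NT) (Ant NT) ℂ}
    {tb yb : ℝ} {x : Point N NT NR} {y : ℝ} (h : S.SurrogateFeasible s Xb tb yb x y)
    (hXb : Xb.PosSemidef) (htb : 0 < tb) (hyb : 0 < yb)
    (ho : S.sinr s.other x.X < S.sinrLin s Xb x.X) (hf : x.t < S.sinrLin s Xb x.X)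
    (h2 : √(tb * yb) + 1 / 2 * √(yb / tb) * (x.t - tb) + 1 / 2 * √(tb / yb) * (y - yb)
      < (S.amp x).re) {X' : ℕ → Matrix (Ant NT) (Ant NT) ℂ} {t' y' : ℕ → ℝ}
    (hX' : Tendsto X' atTop (𝓝 Xb)) (ht' : Tendsto t' atTop (𝓝 tb))
    (hy' : Tendsto y' atTop (𝓝 yb)) :
    ∀ᶠ j in atTop, S.SurrogateFeasible s (X' j) (t' j) (y' j) x y := by
  have hl : Tendsto (fun j => S.sinrLin s (X' j) x.X) atTop (𝓝 (S.sinrLin s Xb x.X)) := by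
    have hF : EntryDiffAt (fun p : Ant NT → Ant NT → ℂ => Matrix.of p) (Matrix.of.symm Xb) :=
      fun i j => by
        change DifferentiableAt ℝ (fun p : Ant NT → Ant NT → ℂ => p i j) _
        fun_prop
    exact (hS.differentiableAt_sinrLin s hF hXb x.X).continuousAt.tendsto.comp hX'
  have hT : Tendsto (fun j => √(t' j * y' j) + 1 / 2 * √(y' j / t' j) * (x.t - t' j)
      + 1 / 2 * √(t' j / y' j) * (y - y' j)) atTop
      (𝓝 (√(tb * yb) + 1 / 2 * √(yb / tb) * (x.t - tb) + 1 / 2 * √(tb / yb) * (y - yb))) :=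
    (((ht'.mul hy').sqrt).add ((((hy'.div ht' htb.ne').sqrt).const_mul _).mul
      (ht'.const_sub _))).add ((((ht'.div hy' hyb.ne').sqrt).const_mul _).mul (hy'.const_sub _))
  filter_upwards [hl.eventually_const_lt ho, hl.eventually_const_lt hf,
    hT.eventually_lt_const h2] with j h1 h3 h4
  -- Only these three constraints involve the linearization point.
  exact { h with order := h1.le, first := h3.le, second := h4.le }

end System

/-! ### Excluding ascent directions at accumulation points. -/

/-- Rotation of the transmitted signals by a common phase. -/
def Point.rotate (x : Point N NT NR) (u : ℂ) : Point N NT NR :=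
  { x with w := u • x.w, v := u • x.v }

/-- The squared amplitude exceeds the squared tangent of the geometric mean. -/
theorem geomMean_tangent_sq_gap {p q I A : ℝ} (hp : 0 < p) (hq : 0 < q) (hI : 0 < I)
    (hIq : I ≤ q ^ 2) (hA : p * q ≤ A) :
    0 ≤ A ^ 2 - (1 / 2 * (q / p) * p ^ 2 + 1 / 2 * (p / q) * I) ^ 2 ∧
      (A ^ 2 - (1 / 2 * (q / p) * p ^ 2 + 1 / 2 * (p / q) * I) ^ 2 = 0 →
        I = q ^ 2 ∧ A = p * q) := by
  have e1 : 1 / 2 * (q / p) * p ^ 2 = p * q / 2 := by field_simp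
  -- The tangent value is thus `p * q` minus a nonnegative multiple of `q ^ 2 - I`, so the gap
  -- vanishes only if both slacks do.
  have e2 : 1 / 2 * (p / q) * I = p * q / 2 - p / q / 2 * (q ^ 2 - I) := by field_simp; ring
  have h0 : 0 < 1 / 2 * (q / p) * p ^ 2 + 1 / 2 * (p / q) * I := by positivity
  have h3 : 0 ≤ p / q / 2 * (q ^ 2 - I) := mul_nonneg (by positivity) (by linarith)
  rw [e1, e2] at h0 ⊢
  have hpq := mul_pos hp hq
  refine ⟨by nlinarith, fun h => ?_⟩
  have h4 : A = p * q / 2 + (p * q / 2 - p / q / 2 * (q ^ 2 - I)) := by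
    nlinarith
  have h5 : p / q / 2 * (q ^ 2 - I) = 0 := by linarith
  have h6 : q ^ 2 - I = 0 := (mul_eq_zero.mp h5).resolve_left (by positivity)
  exact ⟨by linarith, by linarith⟩

theorem posSemidef_add_smul {n : Type*} {X D : Matrix n n ℂ} (hX : X.PosSemidef)
    (hD : (X + D).PosSemidef) {τ : ℝ} (h0 : 0 ≤ τ) (h1 : τ ≤ 1) : (X + τ • D).PosSemidef := by
  have e : X + τ • D = (1 - τ) • X + τ • (X + D) := by module
  rw [e]
  exact (hX.smul (by linarith)).add (hD.smul h0)

namespace System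

variable {S : System K N M NT NR} {s : Node}

theorem amp_rotate (x : Point N NT NR) (u : ℂ) : S.amp (x.rotate u) = u * S.amp x := by
  simp only [amp, Point.rotate, dotProduct_smul, smul_eq_mul]
  ring

/-- A common phase rotation of the signals turns a strictly feasible point into a strictly feasible
point of the convexified subproblem. -/
theorem Admissible.exists_surrogateFeasible (hS : S.Admissible) {Xb : Matrix (Ant NT) (Ant NT) ℂ}
    {tb yb : ℝ} {x : Point N NT NR} (hX : x.X.PosSemidef) (hQ : x.Q.PosSemidef)
    (hx : ∀ i, 0 ≤ S.con s i x) (htb : 0 < tb) (hyb : 0 < yb)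
    (ho : S.sinr s.other x.X < S.sinrLin s Xb x.X) (hf : x.t < S.sinrLin s Xb x.X)
    (h2 : 1 / 2 * (√yb / √tb) * x.t + 1 / 2 * (√tb / √yb) * S.interf x.Q < ‖S.amp x‖) :
    ∃ (x' : Point N NT NR) (y : ℝ), x'.X = x.X ∧ x'.t = x.t ∧ S.obj x' = S.obj x ∧
      S.SurrogateFeasible s Xb tb yb x' y ∧
      √(tb * yb) + 1 / 2 * √(yb / tb) * (x'.t - tb) + 1 / 2 * √(tb / yb) * (y - yb)
        < (S.amp x').re := by
  have hc : 0 < 1 / 2 * (√tb / √yb) := by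
    have := Real.sqrt_pos.mpr htb
    have := Real.sqrt_pos.mpr hyb
    positivity
  have hint := hS.interf_pos hQ
  have ht : 0 ≤ x.t := hx .tpos
  -- The tangent inequality is strict at the interference level, so it persists for `y` slightly
  -- above it.
  obtain ⟨y, hy1, hy2⟩ : ∃ y, S.interf x.Q < y ∧
      1 / 2 * (√yb / √tb) * x.t + 1 / 2 * (√tb / √yb) * y < ‖S.amp x‖ := by
    have hcont : Continuous fun y : ℝ => 1 / 2 * (√yb / √tb) * x.t + 1 / 2 * (√tb / √yb) * y := by
      fun_prop
    have h := (hcont.continuousAt.eventually_lt_const h2).filter_mono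
      (nhdsWithin_le_nhds : 𝓝[>] (S.interf x.Q) ≤ 𝓝 (S.interf x.Q))
    obtain ⟨y, hy, hy'⟩ := (h.and self_mem_nhdsWithin).exists
    exact ⟨y, hy', hy⟩
  have hne : S.amp x ≠ 0 := by
    rw [← norm_pos_iff]
    refine lt_of_le_of_lt ?_ h2
    positivity
  have hnz : (‖S.amp x‖ : ℂ) ≠ 0 := by simpa using hne
  -- This phase makes the amplitude real and positive, so that its real part equals its modulus.
  -- Powers and objective do not see the rotation.
  obtain ⟨u, hu1, hu2⟩ : ∃ u : ℂ, ‖u‖ = 1 ∧ u * S.amp x = ‖S.amp x‖ := by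
    refine ⟨‖S.amp x‖ / S.amp x, ?_, div_mul_cancel₀ _ hne⟩
    rw [norm_div, Complex.norm_real, norm_norm, div_self (norm_ne_zero_iff.mpr hne)]
  have hnorm : ∀ z : ℂ, ‖u * z‖ = ‖z‖ := fun z => by rw [norm_mul, hu1, one_mul]
  have hsec : √(tb * yb) + 1 / 2 * √(yb / tb) * (x.t - tb) + 1 / 2 * √(tb / yb) * (y - yb)
      < (S.amp (x.rotate u)).re := by
    rw [amp_rotate, hu2, Complex.ofReal_re, geomMean_tangent_eq htb hyb]
    exact hy2
  refine ⟨x.rotate u, y, rfl, rfl, rfl, ?_, hsec⟩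
  exact
    { wit := fun k => by
        have := sub_nonneg.mp (hx (.wit k))
        simpa [witPower, Point.rotate, hnorm, hu1] using this
      wpt := fun k => sub_nonneg.mp (hx (.wpt k))
      order := ho.le
      first := hf.le
      interf := hy1.le
      second := hsec.le
      power := by
        have := sub_nonneg.mp (hx .power)
        simpa [Point.rotate, hnorm, hu1] using this
      cost := by
        have := sub_nonneg.mp (hx .cost)
        simpa [Point.rotate, dotProduct_smul, hnorm, hu1] using this
      X_psd := hX
      Q_psd := hQ
      t_nonneg := ht
      y_nonneg := (hint.trans hy1).le }

/-- At an accumulation point with positive `t`, no direction that points into the semidefinite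
cones and strictly increases every active constraint increases the objective. -/
theorem IsSCARun.no_ascent (hS : S.Admissible) {x : ℕ → Point N NT NR} {y : ℕ → ℝ}
    (hrun : S.IsSCARun s x y) {a : Point N NT NR} {φ : ℕ → ℕ}
    (ha : Point.ConvergesTo (fun j => x (φ j)) a) (hfa : S.Feasible s a) (ht : 0 < a.t)
    (hobj : ∀ n, S.obj (x n) ≤ S.obj a) {d : Point N NT NR} (hdX : (a.X + d.X).PosDef)
    (hdQ : (a.Q + d.Q).PosDef)
    (hd : ∀ i, S.con s i a = 0 →
      ∃ m : ℝ, 0 < m ∧ HasDerivAt (fun τ : ℝ => S.con s i (a.along d τ)) m 0)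
    {m₀ : ℝ} (hm₀ : HasDerivAt (fun τ : ℝ => S.obj (a.along d τ)) m₀ 0) : m₀ ≤ 0 := by
  by_contra! hm₀pos
  obtain ⟨ψ, ys, hψ, hys, hint, hsq⟩ := hrun.exists_tendsto_aux hS ha ht
  have hI0 := hS.interf_pos hfa.Q_psd
  have hyspos : 0 < ys := hI0.trans_le hint
  have hcon : ∀ i, ∃ m : ℝ, HasDerivAt (fun τ : ℝ => S.con s i (a.along d τ)) m 0 ∧
      (S.con s i a = 0 → 0 < m) := by
    intro i
    by_cases h : S.con s i a = 0
    · obtain ⟨m, hm, hder⟩ := hd i h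
      exact ⟨m, hder, fun _ => hm⟩
    · exact ⟨_, Point.hasDerivAt_along (hS.differentiableAt_con s hfa.X_psd hfa.Q_psd i) d,
        fun h' => absurd h' h⟩
  have evcon : ∀ i, ∀ᶠ τ in 𝓝[>] (0 : ℝ), 0 < S.con s i (a.along d τ) := by
    intro i
    obtain ⟨m, hder, hm⟩ := hcon i
    refine eventually_pos_of_hasDerivAt hder ?_ fun h => hm ?_
    · simpa [Point.along_zero] using hfa.ineq i
    · simpa [Point.along_zero] using h
  have evall : ∀ᶠ τ in 𝓝[>] (0 : ℝ), (∀ k, 0 < S.con s (.wit k) (a.along d τ)) ∧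
      ∀ k, 0 < S.con s (.wpt k) (a.along d τ) :=
    (eventually_all.mpr fun k => evcon (.wit k)).and (eventually_all.mpr fun k => evcon (.wpt k))
  have hlin := hasDerivAt_sinrLin (S := S) s a.X d.X
  have hsinr := fun s => hS.hasDerivAt_sinr s hfa.X_psd d.X
  have htd : HasDerivAt (fun τ : ℝ => a.t + τ * d.t) d.t 0 := by
    simpa using ((hasDerivAt_id (0 : ℝ)).mul_const d.t).const_add a.t
  have evorder : ∀ᶠ τ in 𝓝[>] (0 : ℝ), 0 < S.sinrLin s a.X (a.X + τ • d.X)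
      - S.sinr s.other (a.X + τ • d.X) := by
    obtain ⟨m, hder, hm⟩ := hcon .order
    -- The linearized SINR has the value and the slope of the true one at `a.X`, so the ascent of an
    -- active constraint carries over.
    have hmeq : m = S.sinrDeriv s a.X d.X - S.sinrDeriv s.other a.X d.X :=
      hder.unique ((hsinr s).sub (hsinr s.other))
    refine eventually_pos_of_hasDerivAt (hlin.sub (hsinr s.other)) ?_ fun h => ?_
    · simpa [sinrLin_self, con] using hfa.ineq .order
    · rw [← hmeq]
      exact hm (by simpa [sinrLin_self, con] using h)
  have evfirst : ∀ᶠ τ in 𝓝[>] (0 : ℝ), 0 < S.sinrLin s a.X (a.X + τ • d.X)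
      - (a.t + τ * d.t) := by
    obtain ⟨m, hder, hm⟩ := hcon .first
    have hmeq : m = S.sinrDeriv s a.X d.X - d.t := hder.unique ((hsinr s).sub htd)
    refine eventually_pos_of_hasDerivAt (hlin.sub htd) ?_ fun h => ?_
    · simpa [sinrLin_self, con] using hfa.ineq .first
    · rw [← hmeq]
      exact hm (by simpa [sinrLin_self, con] using h)
  have evobj : ∀ᶠ τ in 𝓝[>] (0 : ℝ), 0 < S.obj (a.along d τ) - S.obj a :=
    eventually_pos_of_hasDerivAt (hm₀.sub_const _) (by simp [Point.along_zero]) fun _ => hm₀pos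
  set p := √a.t with hp
  set q := √ys with hq
  have hppos : 0 < p := Real.sqrt_pos.mpr ht
  have hqpos : 0 < q := Real.sqrt_pos.mpr hyspos
  have hp2 : p ^ 2 = a.t := Real.sq_sqrt ht.le
  have hq2 : q ^ 2 = ys := Real.sq_sqrt hyspos.le
  have hamp : p * q ≤ ‖S.amp a‖ := by
    rw [hp, hq, ← Real.sqrt_mul ht.le]
    exact hsq.trans (Complex.re_le_norm _)
  -- The first term is `‖amp‖ ^ 2`, written through the constraint function so that its given slope
  -- enters; squaring also keeps everything differentiable. The limit of `y` may exceed the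
  -- interference at `a`, but by `geomMean_tangent_sq_gap` the expression then starts out strictly
  -- positive.
  have evsecond : ∀ᶠ τ in 𝓝[>] (0 : ℝ), 0 < S.interf (a.Q + τ • d.Q) *
      (S.con s .second (a.along d τ) + (a.t + τ * d.t)) -
      (1 / 2 * (q / p) * (a.t + τ * d.t) + 1 / 2 * (p / q) * S.interf (a.Q + τ • d.Q)) ^ 2 := by
    obtain ⟨m, hder, hm⟩ := hcon .second
    obtain ⟨I', hI'⟩ : ∃ I', HasDerivAt (fun τ : ℝ => S.interf (a.Q + τ • d.Q)) I' 0 :=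
      ⟨_, Point.hasDerivAt_along (f := fun x => S.interf x.Q)
        (differentiableAt_interf a.coords) d⟩
    have hΦ := (hI'.mul (hder.add htd)).sub
      (((htd.const_mul (1 / 2 * (q / p))).add (hI'.const_mul (1 / 2 * (p / q)))).pow 2)
    have hA : S.interf a.Q * (S.con s .second a + a.t) = ‖S.amp a‖ ^ 2 := by
      simp only [con]
      field_simp
      ring
    have hgap := geomMean_tangent_sq_gap hppos hqpos hI0 (hint.trans_eq hq2.symm) hamp
    rw [hp2] at hgap
    refine eventually_pos_of_hasDerivAt hΦ ?_ fun h => ?_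
    · simpa [Point.along_zero, hA] using hgap.1
    · have h' := hgap.2 (by simpa [Point.along_zero, hA] using h)
      have hcon0 : S.con s .second a = 0 := by
        have e := hA
        rw [h'.2, h'.1, mul_pow, hp2, mul_comm a.t] at e
        have := mul_left_cancel₀ (pow_pos hqpos 2).ne' e
        linarith
      -- In this tight case the terms in `I'` and `d.t` cancel, and the derivative is `q ^ 2 * m`.
      have hmpos := hm hcon0
      have : 0 < q ^ 2 * m := by positivity
      convert this using 1
      simp only [Pi.add_apply, zero_smul, add_zero, zero_mul, Point.along_zero, hcon0, h'.1,
        zero_add, ← hp2]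
      simp
      field_simp
      ring
  have evlt : ∀ᶠ τ in 𝓝[>] (0 : ℝ), τ < 1 := nhdsWithin_le_nhds (gt_mem_nhds one_pos)
  obtain ⟨τ, hτ⟩ := (evall.and <| (evcon .order).and <| (evcon .first).and <|
    (evcon .second).and <| (evcon .power).and <| (evcon .cost).and <| (evcon .tpos).and <|
    evorder.and <| evfirst.and <| evobj.and <| evsecond.and <| evlt.and
      self_mem_nhdsWithin).exists
  obtain ⟨⟨c1, c2⟩, c3, c4, c5, c6, c7, c8, ho, hf, hob, hs, hlt, hpos⟩ := hτ
  have hX := posSemidef_add_smul hfa.X_psd hdX.posSemidef (le_of_lt hpos) hlt.le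
  have hQ := posSemidef_add_smul hfa.Q_psd hdQ.posSemidef (le_of_lt hpos) hlt.le
  have hI1 := hS.interf_pos hQ
  have hsec : 1 / 2 * (√ys / √a.t) * (a.along d τ).t
      + 1 / 2 * (√a.t / √ys) * S.interf (a.along d τ).Q < ‖S.amp (a.along d τ)‖ := by
    refine lt_of_pow_lt_pow_left₀ 2 (norm_nonneg _) ?_
    have e : S.interf (a.Q + τ • d.Q) * (S.con s .second (a.along d τ) + (a.t + τ * d.t))
        = ‖S.amp (a.along d τ)‖ ^ 2 := by
      have : S.con s .second (a.along d τ)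
        = ‖S.amp (a.along d τ)‖ ^ 2 / S.interf (a.Q + τ • d.Q) - (a.t + τ * d.t) := rfl
      rw [this, sub_add_cancel, mul_div_cancel₀ _ hI1.ne']
    rw [e] at hs
    exact sub_pos.mp hs
  obtain ⟨x', y', e1, e2, e3, hsur, hsecond⟩ := hS.exists_surrogateFeasible
    (x := a.along d τ) (Xb := a.X) (s := s) hX hQ (fun i => by
      cases i with
      | wit k => exact (c1 k).le
      | wpt k => exact (c2 k).le
      | order => exact c3.le
      | first => exact c4.le
      | second => exact c5.le
      | power => exact c6.le
      | cost => exact c7.le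
      | tpos => exact c8.le) ht hyspos (sub_pos.mp ho) (sub_pos.mp hf) hsec
  have hψt := hψ.tendsto_atTop
  -- The improving point competes in the problems solved late in the subsequence, so some later
  -- iterate beats the limit value.
  have hev := hsur.eventually hS hfa.X_psd ht hyspos (by rw [e1]; exact sub_pos.mp ho)
    (by rw [e1, e2]; exact sub_pos.mp hf) hsecond (ha.X.comp hψt) (ha.t.comp hψt) hys
  obtain ⟨j, hj⟩ := hev.exists
  have h1 := (hrun.step (φ (ψ j))).2 _ _ hj
  have h2 := hobj (φ (ψ j) + 1)
  linarith

/-! ### The constraint qualification when the ordering constraint is inactive -/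

theorem wptPower_add (k : Fin K) (X Y : Matrix (Ant NT) (Ant NT) ℂ) :
    S.wptPower k (X + Y) = S.wptPower k X + S.wptPower k Y := by
  simp [wptPower, Matrix.mul_add]

theorem wptPower_smul (k : Fin K) (c : ℝ) (X : Matrix (Ant NT) (Ant NT) ℂ) :
    S.wptPower k (c • X) = c * S.wptPower k X := by
  simp [wptPower]

theorem eapPower_add (X Y : Matrix (Ant NT) (Ant NT) ℂ) :
    S.eapPower (X + Y) = S.eapPower X + S.eapPower Y := by
  simp [eapPower, Matrix.mul_add, Matrix.add_mul]

theorem eapPower_smul (c : ℝ) (X : Matrix (Ant NT) (Ant NT) ℂ) :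
    S.eapPower (c • X) = c * S.eapPower X := by
  simp [eapPower, Matrix.mul_smul, Matrix.smul_mul]

theorem eapPower_nonneg {X : Matrix (Ant NT) (Ant NT) ℂ} (hX : X.PosSemidef) :
    0 ≤ S.eapPower X :=
  PosSemidef.re_trace_nonneg (PosSemidef.congr_conj hX _)

theorem sum_norm_sq_scale {ι : Type*} [Fintype ι] (v : ι → ℂ) (τ : ℝ) :
    ∑ i, ‖v i + τ • -v i‖ ^ 2 = (1 - τ) ^ 2 * ∑ i, ‖v i‖ ^ 2 := by
  rw [Finset.mul_sum]
  refine Finset.sum_congr rfl fun i _ => ?_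
  have : v i + τ • -v i = (1 - τ) • v i := by module
  rw [this, norm_smul, mul_pow, Real.norm_eq_abs, sq_abs]

theorem hasDerivAt_one_sub_sq : HasDerivAt (fun τ : ℝ => (1 - τ) ^ 2) (-2) 0 :=
   (((hasDerivAt_id' (0 : ℝ)).const_sub 1).fun_pow 2).congr_deriv (by simp)

/-- Shrinking every power relaxes the budgets, a small multiple of the identity enters the cones,
and a fast decrease of `t` relaxes both rate constraints. Only the ordering of the SINRs is out of
control, and it is inactive. -/
theorem Admissible.mfcq_of_order_pos (hS : S.Admissible) {a : Point N NT NR}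
    (hfa : S.Feasible s a) (ht : 0 < a.t) (hP : 0 < S.η * S.ρ * S.PEH a.X)
    (ho : S.con s .order a ≠ 0) : S.MFCQ s a := by
  have hP0 := hS.P0_pos
  have hC := hS.C_pos
  have hηρ : 0 ≤ S.η * S.ρ := mul_nonneg hS.η_pos.le hS.ρ_nonneg
  have hc3 : 0 ≤ S.c₃ * (S.η * S.ρ) := mul_nonneg hS.c₃_nonneg hηρ
  have hc4 := hS.c₄_nonneg
  have he1 : 0 ≤ S.eapPower (1 : Matrix (Ant NT) (Ant NT) ℂ) :=
    eapPower_nonneg Matrix.PosSemidef.one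
  have hea : 0 ≤ S.eapPower a.X := eapPower_nonneg hfa.X_psd
  -- The identity perturbation must cost less than half of each budget, which is what the shrinking
  -- is sure to free.
  obtain ⟨δ, hδ, hδ1, hδ2, hδ3⟩ : ∃ δ : ℝ, 0 < δ ∧ (∀ k, δ * S.wptPower k 1 < S.P0 / 2) ∧
      δ * N < S.η * S.ρ * S.PEH a.X / 2 ∧
      δ * (S.c₃ * (S.η * S.ρ) * S.eapPower 1) < S.C / 2 := by
    have hev : ∀ (c b : ℝ), 0 < b → ∀ᶠ δ : ℝ in 𝓝[>] 0, δ * c < b := fun c b hb => by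
      have h : Tendsto (fun δ : ℝ => δ * c) (𝓝[>] 0) (𝓝 (0 * c)) :=
        ((continuous_mul_const c).tendsto 0).mono_left nhdsWithin_le_nhds
      exact h.eventually_lt_const (by rwa [zero_mul])
    obtain ⟨δ, h1, h2, h3, h4⟩ := ((eventually_all.mpr fun k : Fin K =>
      hev (S.wptPower k 1) (S.P0 / 2) (by linarith)).and <| 
      (hev N (S.η * S.ρ * S.PEH a.X / 2) (by linarith)).and <|
      (hev (S.c₃ * (S.η * S.ρ) * S.eapPower 1) (S.C / 2) (by linarith)).and self_mem_nhdsWithin).exists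
    exact ⟨δ, h4, h1, h2, h3⟩
  -- `X` shrinks at half the rate of `Q`, so that consumption falls faster than the harvested power
  -- and the energy constraint gains slack.
  let d₀ : Point N NT NR :=
    { X := -(1 / 2 : ℝ) • a.X + δ • 1, Q := -a.Q + δ • 1, w := -a.w, v := -a.v, t := 0 }
  have hder := fun i => Point.hasDerivAt_along (hS.differentiableAt_con s hfa.X_psd hfa.Q_psd i) d₀
  obtain ⟨m₁, hm₁⟩ : ∃ m, HasDerivAt (fun τ : ℝ => S.con s .first (a.along d₀ τ)) m 0 :=
    ⟨_, hder .first⟩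
  obtain ⟨m₂, hm₂⟩ : ∃ m, HasDerivAt (fun τ : ℝ => S.con s .second (a.along d₀ τ)) m 0 :=
    ⟨_, hder .second⟩
  -- This rate of decrease of `t` outweighs any loss in the two rate constraints along `d₀`.
  set κ : ℝ := |m₁| + |m₂| + 1 with hκ
  have hκd : HasDerivAt (fun τ : ℝ => τ * κ) κ 0 := by
    simpa using (hasDerivAt_id (0 : ℝ)).mul_const κ
  refine ⟨{ d₀ with t := -κ }, ?_, ?_, fun i hi => ?_⟩
  · have e : a.X + d₀.X = (1 / 2 : ℝ) • a.X + δ • (1 : Matrix (Ant NT) (Ant NT) ℂ) := by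
      simp only [d₀]; module
    change (a.X + d₀.X).PosDef
    rw [e]
    exact Matrix.PosDef.posSemidef_add (hfa.X_psd.smul (by norm_num)) (Matrix.PosDef.one.smul hδ)
  · have e : a.Q + d₀.Q = δ • (1 : Matrix (Fin N) (Fin N) ℂ) := by
      simp only [d₀]; module
    change (a.Q + d₀.Q).PosDef
    rw [e]
    exact Matrix.PosDef.one.smul hδ
  cases i with
  | wit k =>
    have h0 : S.witPower k a.v = S.P0 := (sub_eq_zero.mp hi).symm
    refine ⟨-(-2 * S.P0), by linarith, ?_⟩
    have e : (fun τ : ℝ => S.con s (.wit k) (a.along { d₀ with t := -κ } τ))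
        = fun τ : ℝ => S.P0 - (1 - τ) ^ 2 * S.P0 := by
      funext τ
      have := sum_norm_sq_scale (fun j => a.v ⟨k, j⟩) τ
      rw [← h0]
      nth_rewrite 1 [h0]
      exact congrArg (S.P0 - ·) this
    rw [e]
    exact (hasDerivAt_one_sub_sq.mul_const S.P0).const_sub _
  | wpt k =>
    have h0 : S.wptPower k a.X = S.P0 := (sub_eq_zero.mp hi).symm
    refine ⟨-(-(1 / 2) * S.P0 + δ * S.wptPower k 1), by linarith [hδ1 k], ?_⟩
    have e : (fun τ : ℝ => S.con s (.wpt k) (a.along { d₀ with t := -κ } τ))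
        = fun τ : ℝ => S.P0 - (S.P0 + τ * (-(1 / 2) * S.P0 + δ * S.wptPower k 1)) := by
      funext τ
      simp only [con, Point.along, d₀, wptPower_add, wptPower_smul, h0]
    rw [e]
    simpa using (((hasDerivAt_id (0 : ℝ)).mul_const
      (-(1 / 2) * S.P0 + δ * S.wptPower k 1)).const_add S.P0).const_sub S.P0
  | order => exact absurd hi ho
  | first =>
    refine ⟨m₁ + κ, by linarith [neg_abs_le m₁, abs_nonneg m₂], ?_⟩
    refine (hm₁.add hκd).congr_of_eventuallyEq (Eventually.of_forall fun τ => ?_)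
    simp only [con, Point.along, d₀, Pi.add_apply]
    ring
  | second =>
    refine ⟨m₂ + κ, by linarith [neg_abs_le m₂, abs_nonneg m₁], ?_⟩
    refine (hm₂.add hκd).congr_of_eventuallyEq (Eventually.of_forall fun τ => ?_)
    simp only [con, amp, Point.along, d₀, Pi.add_apply]
    ring
  | power =>
    set W := ∑ i, ‖a.w i‖ ^ 2 with hW
    have hW0 : 0 ≤ W := by positivity
    have h0 : S.η * S.ρ * S.PEH a.X = a.Q.trace.re + W := sub_eq_zero.mp hi
    have h1 : S.η * S.ρ * S.eapPower a.X ≤ S.η * S.ρ * S.PEH a.X := by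
      refine mul_le_mul_of_nonneg_left ?_ hηρ
      have := hS.Pp_pos
      have : 0 ≤ S.Pp * ∑ i, ‖S.hST i‖ ^ 2 := by positivity
      simp only [PEH]; linarith
    have h2 := mul_nonneg (mul_nonneg hηρ hδ.le) he1
    refine ⟨S.η * S.ρ * (-(1 / 2) * S.eapPower a.X + δ * S.eapPower 1)
      - ((-a.Q.trace.re + δ * N) + -2 * W), by nlinarith, ?_⟩
    have e : (fun τ : ℝ => S.con s .power (a.along { d₀ with t := -κ } τ))
        = fun τ : ℝ => S.η * S.ρ * (S.PEH a.X
          + τ * (-(1 / 2) * S.eapPower a.X + δ * S.eapPower 1))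
          - ((a.Q.trace.re + τ * (-a.Q.trace.re + δ * N)) + (1 - τ) ^ 2 * W) := by
      funext τ
      have := sum_norm_sq_scale a.w τ
      simp only [con, PEH, Point.along, d₀, eapPower_add, eapPower_smul, Pi.add_apply,
        Pi.smul_apply, Pi.neg_apply, this, ← hW]
      simp only [Matrix.trace_add, Matrix.trace_smul, Matrix.trace_neg, Matrix.trace_one,
        Complex.add_re, Complex.smul_re, Complex.neg_re, smul_eq_mul, Fintype.card_fin,
        Complex.natCast_re]
      ring
    rw [e]
    have hid := hasDerivAt_id (0 : ℝ)
    simpa using (((hid.mul_const (-(1 / 2) * S.eapPower a.X + δ * S.eapPower 1)).const_add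
      (S.PEH a.X)).const_mul (S.η * S.ρ)).fun_sub
      (((hid.mul_const (-a.Q.trace.re + δ * N)).const_add a.Q.trace.re).fun_add
        (hasDerivAt_one_sub_sq.mul_const W))
  | cost =>
    set V := ‖star S.gEAP ⬝ᵥ a.v‖ ^ 2 with hV
    have hV0 : 0 ≤ V := by positivity
    have h0 : S.C = S.c₃ * S.η * S.ρ * S.eapPower a.X + S.c₄ * V := sub_eq_zero.mp hi
    have h1 := mul_nonneg hc4 hV0
    refine ⟨-(S.c₃ * S.η * S.ρ * (-(1 / 2) * S.eapPower a.X + δ * S.eapPower 1)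
      + S.c₄ * (-2 * V)), by nlinarith, ?_⟩
    have e : (fun τ : ℝ => S.con s .cost (a.along { d₀ with t := -κ } τ))
        = fun τ : ℝ => S.C - (S.c₃ * S.η * S.ρ * (S.eapPower a.X
          + τ * (-(1 / 2) * S.eapPower a.X + δ * S.eapPower 1)) + S.c₄ * ((1 - τ) ^ 2 * V)) := by
      funext τ
      have h : star S.gEAP ⬝ᵥ (a.v + τ • -a.v) = (1 - τ) • (star S.gEAP ⬝ᵥ a.v) := by
        rw [← dotProduct_smul]
        congr 1
        module
      simp only [con, Point.along, d₀, eapPower_add, eapPower_smul, h, norm_smul, mul_pow,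
        Real.norm_eq_abs, sq_abs, ← hV]
    rw [e]
    have hid := hasDerivAt_id (0 : ℝ)
    simpa using ((((hid.mul_const (-(1 / 2) * S.eapPower a.X + δ * S.eapPower 1)).const_add
      (S.eapPower a.X)).const_mul (S.c₃ * S.η * S.ρ)).fun_add
        ((hasDerivAt_one_sub_sq.mul_const V).const_mul S.c₄)).const_sub S.C
  | tpos => exact absurd hi ht.ne'

end System

/-! ### Multipliers -/

/-- Enumeration of the constraint labels. -/
def Con.equivSum (K : ℕ) : Con K ≃ (Fin K ⊕ Fin K) ⊕ Fin 6 where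
  toFun
    | .wit k => .inl (.inl k)
    | .wpt k => .inl (.inr k)
    | .order => .inr 0
    | .first => .inr 1
    | .second => .inr 2
    | .power => .inr 3
    | .cost => .inr 4
    | .tpos => .inr 5
  invFun
    | .inl (.inl k) => .wit k
    | .inl (.inr k) => .wpt k
    | .inr 0 => .order
    | .inr 1 => .first
    | .inr 2 => .second
    | .inr 3 => .power
    | .inr 4 => .cost
    | .inr 5 => .tpos
  left_inv i := by cases i <;> rfl
  right_inv i := by
    rcases i with (k | k) | j
    · rfl
    · rfl
    · fin_cases j <;> rfl

instance Con.instFintype (K : ℕ) : Fintype (Con K) := Fintype.ofEquiv _ (Con.equivSum K).symm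

theorem Con.sum_eq (f : Con K → ℝ) :
    ∑ i, f i = ∑ k, f (.wit k) + ∑ k, f (.wpt k) + f .order + f .first + f .second + f .power
      + f .cost + f .tpos := by
  rw [← (Con.equivSum K).symm.sum_comp, Fintype.sum_sum_type, Fintype.sum_sum_type,
    Fin.sum_univ_six]
  simp only [Con.equivSum, Equiv.coe_fn_symm_mk]
  ring

namespace System

variable {S : System K N M NT NR} {s : Node}

theorem lagrangian_eq (l : Con K → ℝ) (Z : Matrix (Ant NT) (Ant NT) ℂ)
    (W : Matrix (Fin N) (Fin N) ℂ) (x : Point N NT NR) :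
    S.lagrangian s l Z W x = S.obj x + ∑ i, l i * S.con s i x
      + ((Z * x.X).trace.re + (W * x.Q).trace.re) := by
  rw [Con.sum_eq, lagrangian]
  ring

theorem hasDerivAt_trace_mul {n : Type*} [Fintype n] (Z X D : Matrix n n ℂ) :
    HasDerivAt (fun τ : ℝ => (Z * (X + τ • D)).trace.re) (Z * D).trace.re 0 := by
  have e : (fun τ : ℝ => (Z * (X + τ • D)).trace.re)
      = fun τ : ℝ => (Z * X).trace.re + τ * (Z * D).trace.re := by
    funext τ
    simp [Matrix.mul_add, Matrix.mul_smul, Matrix.trace_add, Matrix.trace_smul]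
  rw [e]
  simpa using ((hasDerivAt_id (0 : ℝ)).mul_const (Z * D).trace.re).const_add (Z * X).trace.re

/-- First-order necessary conditions: if no direction into the interior of the cones that strictly
increases the active constraints increases the objective, the constraint qualification yields
multipliers. -/
theorem Admissible.isKKT_of_no_ascent (hS : S.Admissible) {a : Point N NT NR}
    (hfa : S.Feasible s a) (hq : S.MFCQ s a)
    (hno : ∀ d : Point N NT NR, (a.X + d.X).PosDef → (a.Q + d.Q).PosDef →
      (∀ i, S.con s i a = 0 →
        ∃ m : ℝ, 0 < m ∧ HasDerivAt (fun τ : ℝ => S.con s i (a.along d τ)) m 0) →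
      ∀ m : ℝ, HasDerivAt (fun τ : ℝ => S.obj (a.along d τ)) m 0 → m ≤ 0) :
    S.IsKKT s a := by
  classical
  have hX := hfa.X_psd
  have hQ := hfa.Q_psd
  let D₀ : Coords N NT NR →ₗ[ℝ] ℝ :=
    (fderiv ℝ (fun p => S.obj (Point.ofCoords p)) a.coords).toLinearMap
  let D : Con K → Coords N NT NR →ₗ[ℝ] ℝ := fun i =>
    (fderiv ℝ (fun p => S.con s i (Point.ofCoords p)) a.coords).toLinearMap
  have hD₀ : ∀ d : Point N NT NR,
      HasDerivAt (fun τ : ℝ => S.obj (a.along d τ)) (D₀ d.coords) 0 :=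
    fun d => Point.hasDerivAt_along (S.differentiableAt_obj hQ (hfa.ineq .tpos)) d
  have hD : ∀ i, ∀ d : Point N NT NR,
      HasDerivAt (fun τ : ℝ => S.con s i (a.along d τ)) (D i d.coords) 0 :=
    fun i d => Point.hasDerivAt_along (hS.differentiableAt_con s hX hQ i) d
  let U : Set (Coords N NT NR) := {p | (a.X + Matrix.of p.1).PosDef ∧
    (a.Q + Matrix.of p.2.1).PosDef}
  have posDef_convex : ∀ {n : Type} [Fintype n] {A B C : Matrix n n ℂ} {α β : ℝ},
      (A + B).PosDef → (A + C).PosDef → 0 ≤ α → 0 ≤ β → α + β = 1 →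
      (A + (α • B + β • C)).PosDef := by
    intro n _ A B C α β hB hC hα hβ hαβ
    have e : A + (α • B + β • C) = α • (A + B) + β • (A + C) := by
      obtain rfl : β = 1 - α := by linarith
      module
    rw [e]
    rcases hα.lt_or_eq with h | h
    · exact (hB.smul h).add_posSemidef (hC.posSemidef.smul hβ)
    · have : 0 < β := by linarith
      exact Matrix.PosDef.posSemidef_add (hB.posSemidef.smul hα) (hC.smul this)
  have hU : Convex ℝ U := fun p hp r hr α β hα hβ hαβ =>
    ⟨posDef_convex hp.1 hr.1 hα hβ hαβ, posDef_convex hp.2 hr.2 hα hβ hαβ⟩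
  obtain ⟨l, hl, hle⟩ := exists_multipliers hU D₀
    (fun i : {i : Con K // S.con s i a = 0} => D i)
    (fun p hp hpos => hno (Point.ofCoords p) hp.1 hp.2
      (fun i hi => ⟨_, hpos ⟨i, hi⟩, hD i (Point.ofCoords p)⟩) _ (hD₀ (Point.ofCoords p)))
    (by
      obtain ⟨d, hdX, hdQ, hd⟩ := hq
      refine ⟨d.coords, ⟨hdX, hdQ⟩, fun i => ?_⟩
      obtain ⟨m, hm, hder⟩ := hd i i.2
      exact (hder.unique (hD i d)) ▸ hm)
  -- Extension by zero to the inactive constraints gives complementary slackness.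
  let l' : Con K → ℝ := fun i => if h : S.con s i a = 0 then l ⟨i, h⟩ else 0
  let F : Coords N NT NR →ₗ[ℝ] ℝ := D₀ + ∑ i, l' i • D i
  have hF : ∀ p, F p = D₀ p + ∑ i, l' i * D i p := fun p => by simp [F]
  have hFU : ∀ p ∈ U, F p ≤ 0 := by
    intro p hp
    have h := hle p hp
    rw [hF]
    convert h using 2
    rw [← Finset.sum_subset (Finset.subset_univ (Finset.univ.filter fun i => S.con s i a = 0))
      (fun i _ hi => by
        have : S.con s i a ≠ 0 := by simpa using hi
        simp [l', this])]
    rw [Finset.sum_subtype (p := fun i => S.con s i a = 0) _ (fun i => by simp)]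
    exact Finset.sum_congr rfl fun i _ => by simp [l', i.2]
  -- Adding a small multiple of the identity to both blocks enters `U`; letting it tend to zero
  -- extends the inequality to the closed cones.
  have hFcl : ∀ (P : Matrix (Ant NT) (Ant NT) ℂ) (R : Matrix (Fin N) (Fin N) ℂ) w v t,
      (a.X + P).PosSemidef → (a.Q + R).PosSemidef → F (Point.coords ⟨P, R, w, v, t⟩) ≤ 0 := by
    intro P R w v t hP hR
    let e : Coords N NT NR := Point.coords ⟨1, 1, 0, 0, 0⟩
    have ht : Tendsto (fun ε : ℝ => F (Point.coords ⟨P, R, w, v, t⟩) + ε * F e) (𝓝[>] 0)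
        (𝓝 (F (Point.coords ⟨P, R, w, v, t⟩))) := by
      have : Continuous fun ε : ℝ => F (Point.coords ⟨P, R, w, v, t⟩) + ε * F e := by fun_prop
      simpa using (this.tendsto 0).mono_left (nhdsWithin_le_nhds (s := Set.Ioi 0))
    refine le_of_tendsto ht ?_
    filter_upwards [self_mem_nhdsWithin] with ε hε
    have hmem : Point.coords ⟨P, R, w, v, t⟩ + ε • e ∈ U := by
      constructor
      · change (a.X + (P + ε • (1 : Matrix (Ant NT) (Ant NT) ℂ))).PosDef
        rw [← add_assoc]
        exact Matrix.PosDef.posSemidef_add hP (Matrix.PosDef.one.smul hε)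
      · change (a.Q + (R + ε • (1 : Matrix (Fin N) (Fin N) ℂ))).PosDef
        rw [← add_assoc]
        exact Matrix.PosDef.posSemidef_add hR (Matrix.PosDef.one.smul hε)
    have h := hFU _ hmem
    rwa [map_add, map_smul, smul_eq_mul] at h
  let GX : Matrix (Ant NT) (Ant NT) ℂ →ₗ[ℝ] ℝ :=
    { toFun := fun P => F (Point.coords ⟨P, 0, 0, 0, 0⟩)
      map_add' := fun P R => by
        rw [← map_add, Point.coords_add]; simp only [add_zero]
      map_smul' := fun c P => by
        rw [RingHom.id_apply, ← map_smul, Point.coords_smul]; simp only [smul_zero, mul_zero] }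
  let GQ : Matrix (Fin N) (Fin N) ℂ →ₗ[ℝ] ℝ :=
    { toFun := fun P => F (Point.coords ⟨0, P, 0, 0, 0⟩)
      map_add' := fun P R => by
        rw [← map_add, Point.coords_add]; simp only [add_zero]
      map_smul' := fun c P => by
        rw [RingHom.id_apply, ← map_smul, Point.coords_smul]; simp only [smul_zero, mul_zero] }
  have hGX : ∀ P : Matrix (Ant NT) (Ant NT) ℂ, (a.X + P).PosSemidef → GX P ≤ 0 :=
    fun P hP => hFcl P 0 0 0 0 hP (by simpa using hQ)
  have hGQ : ∀ P : Matrix (Fin N) (Fin N) ℂ, (a.Q + P).PosSemidef → GQ P ≤ 0 :=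
    fun P hP => hFcl 0 P 0 0 0 (by simpa using hX) hP
  -- These components are unconstrained by the cones, so both signs are admissible and the
  -- functional vanishes on them.
  have hrest : ∀ w v t, F (Point.coords ⟨0, 0, w, v, t⟩) = 0 := by
    intro w v t
    have h1 : ∀ w v t, F (Point.coords ⟨0, 0, w, v, t⟩) ≤ 0 := fun w v t =>
      hFcl 0 0 w v t (by simpa using hX) (by simpa using hQ)
    refine le_antisymm (h1 w v t) ?_
    have h2 := h1 (-w) (-v) (-t)
    have e : Point.coords ⟨0, 0, -w, -v, -t⟩ = -Point.coords (NT := NT) ⟨0, 0, w, v, t⟩ := by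
      rw [Point.coords_neg]; simp only [neg_zero]
    rw [e, map_neg] at h2
    linarith
  obtain ⟨Z, hZ, hZr⟩ := exists_posSemidef_repr GX fun P hP => hGX P (hX.add hP)
  obtain ⟨W, hW, hWr⟩ := exists_posSemidef_repr GQ fun P hP => hGQ P (hQ.add hP)
  -- Both `a.X` and `-a.X` are admissible directions from `a.X`; this yields complementarity of `Z`
  -- and `a.X`.
  have hGX0 : GX a.X = 0 := by
    refine le_antisymm (hGX _ (hX.add hX)) ?_
    have h := hGX (-a.X) (by rw [add_neg_cancel]; exact Matrix.PosSemidef.zero)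
    rw [map_neg] at h
    linarith
  have hGQ0 : GQ a.Q = 0 := by
    refine le_antisymm (hGQ _ (hQ.add hQ)) ?_
    have h := hGQ (-a.Q) (by rw [add_neg_cancel]; exact Matrix.PosSemidef.zero)
    rw [map_neg] at h
    linarith
  refine ⟨hfa, l', Z, W, fun i => ?_, hZ, hW, fun i => ?_, ?_, ?_, fun d hdX hdQ => ?_⟩
  · simp only [l']
    split_ifs with h
    · exact hl _
    · exact le_rfl
  · by_cases h : S.con s i a = 0
    · rw [h, mul_zero]
    · simp [l', h]
  · refine trace_mul_eq_zero_of_re hZ.isHermitian hX.isHermitian ?_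
    linarith [hZr a.X hX.isHermitian]
  · refine trace_mul_eq_zero_of_re hW.isHermitian hQ.isHermitian ?_
    linarith [hWr a.Q hQ.isHermitian]
  · have hder := ((hD₀ d).add (HasDerivAt.fun_sum (u := Finset.univ) fun i _ =>
      (hD i d).const_mul (l' i))).add
      ((hasDerivAt_trace_mul Z a.X d.X).add (hasDerivAt_trace_mul W a.Q d.Q))
    have hsplit : F d.coords = GX d.X + GQ d.Q := by
      have e : d.coords = Point.coords ⟨d.X, 0, 0, 0, 0⟩
          + (Point.coords ⟨0, d.Q, 0, 0, 0⟩ + Point.coords ⟨0, 0, d.w, d.v, d.t⟩) := by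
        rw [Point.coords_add, Point.coords_add]
        simp only [add_zero, zero_add]
      rw [e, map_add, map_add, hrest, add_zero]
      rfl
    have hzero : D₀ d.coords + ∑ i, l' i * D i d.coords
        + ((Z * d.X).trace.re + (W * d.Q).trace.re) = 0 := by
      rw [← hF, hsplit]
      linarith [hZr _ hdX, hWr _ hdQ]
    rw [hzero] at hder
    refine hder.congr_of_eventuallyEq (Eventually.of_forall fun τ => ?_)
    exact lagrangian_eq l' Z W (a.along d τ)

end System

end CCRN

end


theorem proposition4p1 {K N M : ℕ} {NT NR : Fin K → ℕ} (S : CCRN.System K N M NT NR)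
    (hS : S.Admissible) (s : CCRN.Node) (x : ℕ → CCRN.Point N NT NR) (y : ℕ → ℝ)
    (hrun : S.IsSCARun s x y) :
    -- the objective values are non-decreasing
    (∀ n, S.obj (x n) ≤ S.obj (x (n + 1))) ∧
    -- the iterates are bounded and have an accumulation point
    (∃ R : ℝ, ∀ n, (x n).BoundedBy R) ∧
    (∃ (a : CCRN.Point N NT NR) (φ : ℕ → ℕ), StrictMono φ ∧
      CCRN.Point.ConvergesTo (fun j => x (φ j)) a) ∧
    -- the objective values converge, to the objective value of each accumulation point; each
    -- accumulation point satisfies all the constraints and the KKT conditions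
    ∃ h : ℝ, Tendsto (fun n => S.obj (x n)) atTop (𝓝 h) ∧
      ∀ (a : CCRN.Point N NT NR) (φ : ℕ → ℕ), StrictMono φ →
        CCRN.Point.ConvergesTo (fun j => x (φ j)) a →
        S.obj a = h ∧ S.Feasible s a ∧
        (0 < a.t → 0 < S.η * S.ρ * S.PEH a.X →
          (S.con s .order a = 0 → S.MFCQ s a) → S.IsKKT s a) := by
  have hfeas := hrun.feasible hS
  have hmono : Monotone fun n => S.obj (x n) := monotone_nat_of_le_succ (hrun.obj_le_succ hS)
  obtain ⟨R, hR, hbd⟩ := hS.exists_bound s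
  have hacc := CCRN.System.exists_accumulation hR fun n => hbd _ (hfeas n)
  refine ⟨hrun.obj_le_succ hS, ⟨R, fun n => hbd _ (hfeas n)⟩, hacc, ?_⟩
  have hlim : ∀ (a : CCRN.Point N NT NR) (φ : ℕ → ℕ), StrictMono φ →
      CCRN.Point.ConvergesTo (fun j => x (φ j)) a →
      S.Feasible s a ∧ Tendsto (fun n => S.obj (x n)) atTop (𝓝 (S.obj a)) := by
    intro a φ hφ ha
    have hfa := hS.feasible_of_tendsto (fun j => hfeas (φ j)) ha
    -- Monotonicity upgrades convergence along the subsequence to the whole sequence, so all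
    -- accumulation points share one objective value.
    exact ⟨hfa, (tendsto_iff_tendsto_subseq_of_monotone hmono hφ.tendsto_atTop).mpr
      (CCRN.System.tendsto_obj hfa ha)⟩
  obtain ⟨a₀, φ₀, hφ₀, ha₀⟩ := hacc
  refine ⟨S.obj a₀, (hlim a₀ φ₀ hφ₀ ha₀).2, fun a φ hφ ha => ?_⟩
  obtain ⟨hfa, hta⟩ := hlim a φ hφ ha
  refine ⟨tendsto_nhds_unique hta (hlim a₀ φ₀ hφ₀ ha₀).2, hfa, fun ht hP hq => ?_⟩
  have hq' : S.MFCQ s a := by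
    by_cases ho : S.con s .order a = 0
    · exact hq ho
    · exact hS.mfcq_of_order_pos hfa ht hP ho
  refine hS.isKKT_of_no_ascent hfa hq' fun d hdX hdQ hd m hm => ?_
  exact hrun.no_ascent hS ha hfa ht (hmono.ge_of_tendsto hta) hdX hdQ hd hm
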